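/- **Theorem.** Let $\mathbb H$ be the real quaternion algebra. For a quaternion matrix $A$ let $r(A)$ be its rank (the dimension of the right $\mathbb H$-span of its columns), $A^*$ its conjugate transpose, $A^\dagger$ its Moore–Penrose inverse (the unique $X$ with $AXA=A$, $XAX=X$, $(AX)^*=AX$, $(XA)^*=XA$), and put $L_A=I-A^\dagger A$, $R_A=I-AA^\dagger$. Let $A_i\in\mathbb H^{n_{i+1}\times n_i}$, $B_i\in\mathbb H^{q_{i+1}\times q_i}$, $C_i\in\mathbb H^{n_{i+1}\times q_i}$ $(i=1,2,3,4)$ be given, and consider the system $$A_iX_i-X_{i+1}B_i=C_i\qquad(i=1,2,3,4)\tag{$*$}$$ in the unknowns $X_i\in\mathbb H^{n_i\times q_i}$ $(i=1,\dots,5)$. For $j=1,2$ set $$A_{jj}=R_{(A_{2j}A_{2j-1})}A_{2j},\quad B_{jj}=R_{B_{2j-1}}L_{B_{2j}},\quad C_{jj}=R_{(A_{2j}A_{2j-1})}\bigl(A_{2j}R_{A_{2j-1}}C_{2j-1}B_{2j-1}^\dagger+C_{2j}\bigr)L_{B_{2j}},$$ and set $$A_{33}=(A_2A_1,\,-L_{A_3}),\quad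 B_{33}=\begin{pmatrix}R_{B_2}\\-B_4B_3\end{pmatrix},\quad A_{44}=R_{B_{11}}R_{B_1}B_2^\dagger,\quad B_{44}=-L_{(A_4A_3)},$$ $$E_1=A_3^\dagger C_3+(A_4A_3)^\dagger C_4B_3+(A_4A_3)^\dagger A_4R_{A_3}C_3+R_{(A_2A_1)}C_2B_2^\dagger+A_{11}R_{A_1}C_1B_1^\dagger B_2^\dagger-C_{11}B_{11}^\dagger R_{B_1}B_2^\dagger,$$ $$A=R_{A_{33}}A_{11},\quad B=A_{44}L_{B_{33}},\quad C=R_{A_{33}}B_{44},\quad D=B_3L_{B_{33}},$$ $$E=R_{A_{33}}E_1L_{B_{33}},\quad M=R_AC,\quad N=DL_B,\quad S=CL_M.$$ Then the following are equivalent. (1) The system $(*)$ has a solution. (2) The following ten rank equalities hold: $$r\begin{pmatrix}C_i&A_i\\B_i&0\end{pmatrix}=r(A_i)+r(B_i)\quad(i=1,2,3,4),$$ $$r\begin{pmatrix}A_{k+1}C_k+C_{k+1}B_k&A_{k+1}A_k\\B_{k+1}B_k&0\end{pmatrix}=r(A_{k+1}A_k)+r(B_{k+1}B_k)\quad(k=1,2,3),$$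 $$r\begin{pmatrix}A_{j+2}A_{j+1}C_j+A_{j+2}C_{j+1}B_j+C_{j+2}B_{j+1}B_j&A_{j+2}A_{j+1}A_j\\B_{j+2}B_{j+1}B_j&0\end{pmatrix}=r(A_{j+2}A_{j+1}A_j)+r(B_{j+2}B_{j+1}B_j)\quad(j=1,2),$$ $$r\begin{pmatrix}A_4A_3A_2C_1+A_4A_3C_2B_1+A_4C_3B_2B_1+C_4B_3B_2B_1&A_4A_3A_2A_1\\B_4B_3B_2B_1&0\end{pmatrix}=r(A_4A_3A_2A_1)+r(B_4B_3B_2B_1).$$ (3) $R_{A_{2j-1}}C_{2j-1}L_{B_{2j-1}}=0$, $R_{A_{jj}}C_{jj}=0$, $C_{jj}L_{B_{jj}}=0$ for $j=1,2$, and $$R_MR_AE=0,\quad EL_BL_N=0,\quad R_AEL_D=0,\quad R_CEL_B=0.$$ Moreover, if $(*)$ has a solution, then its solutions are exactly the tuples $(X_1,\dots,X_5)$ of the form $$X_1=A_1^\dagger C_1+U_1B_1+L_{A_1}W_1,\qquad X_2=-R_{A_1}C_1B_1^\dagger+A_1U_1+V_1R_{B_1},$$ $$X_3=A_3^\dagger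 C_3+U_2B_3+L_{A_3}T_1,\qquad X_4=-R_{A_3}C_3B_3^\dagger+A_3U_2+V_2R_{B_3},$$ $$X_5=-R_{(A_4A_3)}\bigl(C_4+A_4R_{A_3}C_3B_3^\dagger-A_4V_2R_{B_3}\bigr)B_4^\dagger+A_4A_3T_4+T_5R_{B_4},$$ and $X_3$ is then also equal to each of $$-R_{(A_2A_1)}C_2B_2^\dagger-A_{11}R_{A_1}C_1B_1^\dagger B_2^\dagger+C_{11}B_{11}^\dagger R_{B_1}B_2^\dagger+A_{11}W_3A_{44}+A_2A_1W_4+W_5R_{B_2},$$ $$A_3^\dagger C_3+(A_4A_3)^\dagger C_4B_3+(A_4A_3)^\dagger A_4R_{A_3}C_3+L_{A_3}T_1+T_4B_4B_3+L_{(A_4A_3)}T_6B_3,$$ where $$V_1=A_{11}^\dagger C_{11}B_{11}^\dagger+L_{A_{11}}W_2+W_3R_{B_{11}},\qquad V_2=A_{22}^\dagger C_{22}B_{22}^\dagger+L_{A_{22}}T_2+T_3R_{B_{22}},$$ $$U_1=(A_2A_1)^\dagger\bigl(C_2+A_2R_{A_1}C_1B_1^\dagger-A_2V_1R_{B_1}\bigr)+W_4B_2+L_{(A_2A_1)}W_6,$$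 $$U_2=(A_4A_3)^\dagger\bigl(C_4+A_4R_{A_3}C_3B_3^\dagger-A_4V_2R_{B_3}\bigr)+T_4B_4+L_{(A_4A_3)}T_6,$$ $$\begin{pmatrix}W_4\\T_1\end{pmatrix}=A_{33}^\dagger(E_1-A_{11}W_3A_{44}-B_{44}T_6B_3)-A_{33}^\dagger Z_7B_{33}+L_{A_{33}}Z_6,$$ $$(W_5,\,T_4)=R_{A_{33}}(E_1-A_{11}W_3A_{44}-B_{44}T_6B_3)B_{33}^\dagger+A_{33}A_{33}^\dagger Z_7+Z_8R_{B_{33}},$$ $$W_3=A^\dagger EB^\dagger-A^\dagger CM^\dagger EB^\dagger-A^\dagger SC^\dagger EN^\dagger DB^\dagger-A^\dagger SZ_1R_NDB^\dagger+L_AZ_2+Z_3R_B,$$ $$T_6=M^\dagger ED^\dagger+S^\dagger SC^\dagger EN^\dagger+L_ML_SZ_4+L_MZ_1R_N+Z_5R_D,$$ the blocks $W_4,T_1$ have $n_1,n_3$ rows, the blocks $W_5,T_4$ have $q_3,q_5$ columns, and $W_1,W_2,W_6,T_2,T_3,T_5,Z_1,\dots,Z_8$ are arbitrary quaternion matrices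 of the appropriate sizes. -/

import Mathlib

open scoped Quaternion Matrix

/-- Real quaternion matrices of size `m × n`. -/
abbrev HMat (m n : ℕ) := Matrix (Fin m) (Fin n) ℍ[ℝ]

namespace QMatrix

/-- The rank of a quaternion matrix: the dimension of its column space, the *right* `ℍ`-span of
its columns. -/
noncomputable def rank {m n : Type*} (A : Matrix m n ℍ[ℝ]) : ℕ :=
  Module.finrank ℍ[ℝ]ᵐᵒᵖ (Submodule.span ℍ[ℝ]ᵐᵒᵖ (Set.range A.col))

/-- The four Penrose equations. -/
structure IsMoorePenrose {m n : Type*} [Fintype m] [Fintype n]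
    (A : Matrix m n ℍ[ℝ]) (X : Matrix n m ℍ[ℝ]) : Prop where
  mul_mul_self : A * X * A = A
  self_mul_mul : X * A * X = X
  left_herm : (A * X)ᴴ = A * X
  right_herm : (X * A)ᴴ = X * A

theorem eq_zero_of_conjTranspose_mul_self {m n : Type*} [Fintype m]
    {Y : Matrix m n ℍ[ℝ]} (h : Yᴴ * Y = 0) : Y = 0 := by
  ext1 i j
  have h1 := congrFun (congrFun h j) j
  simp only [Matrix.mul_apply, Matrix.conjTranspose_apply, Matrix.zero_apply,
    Quaternion.star_mul_self] at h1
  have h2 : ∑ k, Quaternion.normSq (Y k j) = 0 := by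
    have : ((∑ k, Quaternion.normSq (Y k j) : ℝ) : ℍ[ℝ]) = ((0 : ℝ) : ℍ[ℝ]) := by
      rw [Quaternion.coe_zero, ← h1]
      exact map_sum (algebraMap ℝ ℍ[ℝ]) _ _
    exact Quaternion.coe_injective this
  have h3 := (Finset.sum_eq_zero_iff_of_nonneg
    (fun k _ => Quaternion.normSq_nonneg (a := Y k j))).1 h2 i (Finset.mem_univ i)
  simpa using h3

theorem exists_isMoorePenrose {m n : Type*} [Fintype m] [Fintype n]
    (A : Matrix m n ℍ[ℝ]) : ∃ X, IsMoorePenrose A X := by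
  classical
  -- a real polynomial in the Hermitian matrix `H = Aᴴ * A` is an inner inverse of it
  set H : Matrix n n ℍ[ℝ] := Aᴴ * A with hH
  have hHH : Hᴴ = H := by simp [hH]
  have hcancel : ∀ Y : Matrix n n ℍ[ℝ], ∀ k : ℕ, H ^ k * Y = 0 → H * Y = 0 := by
    intro Y k
    induction k with
    | zero => intro h; simp only [pow_zero, one_mul] at h; simp [h]
    | succ k ih =>
      intro h
      rcases k with _ | k
      · simpa using h
      · apply ih
        apply eq_zero_of_conjTranspose_mul_self
        rw [Matrix.conjTranspose_mul, Matrix.conjTranspose_pow, hHH, pow_succ' H k]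
        have h' : H * (H * H ^ k * Y) = 0 := by
          rw [← Matrix.mul_assoc, ← pow_succ', ← pow_succ']; exact h
        have : Yᴴ * (H * H ^ k) * (H * H ^ k * Y) = Yᴴ * (H ^ k * (H * (H * H ^ k * Y))) := by
          have hc : H * H ^ k = H ^ k * H := by rw [← pow_succ', ← pow_succ]
          conv_lhs => rw [hc]
          conv_rhs => rw [hc]
          simp only [Matrix.mul_assoc]
        rw [this, h']; simp
  have hint : IsIntegral ℝ H := Algebra.IsIntegral.isIntegral H
  obtain ⟨p, hp, hp0⟩ := hint
  have hpne : p ≠ 0 := hp.ne_zero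
  obtain ⟨q, hq, hq0⟩ := Polynomial.exists_eq_pow_rootMultiplicity_mul_and_not_dvd p hpne 0
  have hq0' : q.coeff 0 ≠ 0 := by
    intro h
    apply hq0
    simpa [Polynomial.X_dvd_iff] using h
  have hHq : H * Polynomial.aeval H q = 0 := by
    apply hcancel _ (p.rootMultiplicity 0)
    have : Polynomial.aeval H p = 0 := hp0
    rw [hq] at this
    simpa using this
  -- `q = X * q.divX + C (q.coeff 0)`
  set G : Matrix n n ℍ[ℝ] := Polynomial.aeval H (Polynomial.C (-(q.coeff 0)⁻¹) * q.divX) with hG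
  have hcomm : H * G = G * H := by
    have h1 := congrArg (Polynomial.aeval H)
      (mul_comm Polynomial.X (Polynomial.C (-(q.coeff 0)⁻¹) * q.divX))
    rw [map_mul (Polynomial.aeval H), map_mul (Polynomial.aeval H) _ Polynomial.X,
      Polynomial.aeval_X] at h1
    exact h1
  have hGH : H * (1 - G * H) = 0 := by
    have h1 : Polynomial.aeval H q = Polynomial.aeval H q.divX * H
        + algebraMap ℝ _ (q.coeff 0) := by
      conv_lhs => rw [← Polynomial.divX_mul_X_add q]
      simp
    have h2 : 1 - G * H = (q.coeff 0)⁻¹ • Polynomial.aeval H q := by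
      rw [h1, hG, smul_add, Algebra.algebraMap_eq_smul_one, smul_smul, inv_mul_cancel₀ hq0']
      simp [Algebra.smul_def, Matrix.mul_assoc]
      abel
    rw [h2, Matrix.mul_smul, hHq, smul_zero]
  have hGG : Gᴴ = G := by
    have key : ∀ f : Polynomial ℝ, (Polynomial.aeval H f)ᴴ = Polynomial.aeval H f := by
      intro f
      induction f using Polynomial.induction_on' with
      | add a b ha hb => simp [ha, hb]
      | monomial k a =>
        rw [Polynomial.aeval_monomial, Algebra.algebraMap_eq_smul_one, smul_mul_assoc, one_mul]
        have hs : ∀ Y : Matrix n n ℍ[ℝ], (a • Y)ᴴ = a • Yᴴ := by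
          intro Y
          ext1 i j
          simp only [Matrix.conjTranspose_apply, Matrix.smul_apply, Quaternion.star_smul]
        rw [hs, Matrix.conjTranspose_pow, hHH]
    exact key _
  have hA : A * (1 - G * H) = 0 := by
    apply eq_zero_of_conjTranspose_mul_self
    rw [Matrix.conjTranspose_mul, Matrix.mul_assoc, ← Matrix.mul_assoc Aᴴ, ← hH, hGH,
      Matrix.mul_zero]
  have h1 : A * (G * Aᴴ) * A = A := by
    rw [Matrix.mul_sub, Matrix.mul_one, sub_eq_zero] at hA
    calc A * (G * Aᴴ) * A = A * (G * H) := by simp only [hH, Matrix.mul_assoc]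
      _ = A := hA.symm
  have h3 : (A * (G * Aᴴ))ᴴ = A * (G * Aᴴ) := by
    simp [hGG, Matrix.mul_assoc]
  have h4 : (G * Aᴴ * A)ᴴ = G * Aᴴ * A := by
    rw [Matrix.mul_assoc, ← hH, Matrix.conjTranspose_mul, hHH, hGG, hcomm]
  generalize G * Aᴴ = X at h1 h3 h4
  have e1 : A * (X * A * X) = A * X := by
    rw [← Matrix.mul_assoc, ← Matrix.mul_assoc, h1]
  have e2 : X * A * X * A = X * A := by
    rw [Matrix.mul_assoc X A X, Matrix.mul_assoc X, h1]
  have h5 : X * A * X * A * X = X * A * X := by rw [e2]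
  refine ⟨X * A * X, ?_, ?_, ?_, ?_⟩
  · rw [e1, h1]
  · rw [e2, ← Matrix.mul_assoc, ← Matrix.mul_assoc, h5]
  · rw [e1, h3]
  · rw [e2, h4]

theorem IsMoorePenrose.unique {m n : Type*} [Fintype m] [Fintype n]
    {A : Matrix m n ℍ[ℝ]} {X Y : Matrix n m ℍ[ℝ]}
    (hX : IsMoorePenrose A X) (hY : IsMoorePenrose A Y) : X = Y := by
  have a : A * X = A * Y := by
    calc A * X = (A * Y * A) * X := by rw [hY.mul_mul_self]
      _ = (A * Y)ᴴ * (A * X)ᴴ := by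
        rw [hY.left_herm, hX.left_herm]; simp only [Matrix.mul_assoc]
      _ = ((A * X * A) * Y)ᴴ := by
        rw [← Matrix.conjTranspose_mul]; simp only [Matrix.mul_assoc]
      _ = A * Y := by rw [hX.mul_mul_self, hY.left_herm]
  have b : X * A = Y * A := by
    calc X * A = X * (A * Y * A) := by rw [hY.mul_mul_self]
      _ = (X * A)ᴴ * (Y * A)ᴴ := by
        rw [hY.right_herm, hX.right_herm]; simp only [Matrix.mul_assoc]
      _ = (Y * (A * X * A))ᴴ := by
        rw [← Matrix.conjTranspose_mul]; simp only [Matrix.mul_assoc]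
      _ = Y * A := by rw [hX.mul_mul_self, hY.right_herm]
  calc X = X * A * X := hX.self_mul_mul.symm
    _ = Y * (A * X) := by rw [b, Matrix.mul_assoc]
    _ = Y := by rw [a, ← Matrix.mul_assoc, hY.self_mul_mul]

/-- The Moore–Penrose inverse of `A`: the unique solution of the four Penrose equations. -/
noncomputable def pinv {m n : Type*} [Fintype m] [Fintype n]
    (A : Matrix m n ℍ[ℝ]) : Matrix n m ℍ[ℝ] :=
  (exists_isMoorePenrose A).choose

theorem pinv_spec {m n : Type*} [Fintype m] [Fintype n]
    (A : Matrix m n ℍ[ℝ]) : IsMoorePenrose A (pinv A) :=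
  (exists_isMoorePenrose A).choose_spec

/-- The projector `L_A = I - A† A`. -/
noncomputable def projL {m n : Type*} [Fintype m] [Fintype n] [DecidableEq n]
    (A : Matrix m n ℍ[ℝ]) : Matrix n n ℍ[ℝ] := 1 - pinv A * A

/-- The projector `R_A = I - A A†`. -/
noncomputable def projR {m n : Type*} [Fintype m] [Fintype n] [DecidableEq m]
    (A : Matrix m n ℍ[ℝ]) : Matrix m m ℍ[ℝ] := 1 - A * pinv A

end QMatrix

/-- The coefficient matrices of the chain system
`Aᵢ Xᵢ - Xᵢ₊₁ Bᵢ = Cᵢ` (`i = 1, 2, 3, 4`) in the unknowns `Xᵢ` of size `nᵢ × qᵢ`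
(`i = 1, …, 5`).  The sizes are the most general ones for which all products make sense. -/
structure ChainSystem (n₁ n₂ n₃ n₄ n₅ q₁ q₂ q₃ q₄ q₅ : ℕ) where
  A₁ : HMat n₂ n₁
  A₂ : HMat n₃ n₂
  A₃ : HMat n₄ n₃
  A₄ : HMat n₅ n₄
  B₁ : HMat q₂ q₁
  B₂ : HMat q₃ q₂
  B₃ : HMat q₄ q₃
  B₄ : HMat q₅ q₄
  C₁ : HMat n₂ q₁
  C₂ : HMat n₃ q₂
  C₃ : HMat n₄ q₃
  C₄ : HMat n₅ q₄

/-- The free parameters of the general solution. -/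
structure ChainParams (n₁ n₂ n₃ n₄ n₅ q₁ q₂ q₃ q₄ q₅ : ℕ) where
  W₁ : HMat n₁ q₁
  W₂ : HMat n₂ q₂
  W₆ : HMat n₁ q₂
  T₂ : HMat n₄ q₄
  T₃ : HMat n₄ q₄
  T₅ : HMat n₅ q₅
  Z₁ : HMat n₃ q₄
  Z₂ : HMat n₂ q₂
  Z₃ : HMat n₂ q₂
  Z₄ : HMat n₃ q₄
  Z₅ : HMat n₃ q₄
  Z₆ : Matrix (Fin n₁ ⊕ Fin n₃) (Fin q₃) ℍ[ℝ]
  Z₇ : Matrix (Fin n₃) (Fin q₃ ⊕ Fin q₅) ℍ[ℝ]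
  Z₈ : Matrix (Fin n₃) (Fin q₃ ⊕ Fin q₅) ℍ[ℝ]

namespace ChainSystem

open QMatrix

variable {n₁ n₂ n₃ n₄ n₅ q₁ q₂ q₃ q₄ q₅ : ℕ}

/-- `(X₁, …, X₅)` solves the system. -/
def IsSolution (σ : ChainSystem n₁ n₂ n₃ n₄ n₅ q₁ q₂ q₃ q₄ q₅)
    (X₁ : HMat n₁ q₁) (X₂ : HMat n₂ q₂) (X₃ : HMat n₃ q₃) (X₄ : HMat n₄ q₄)
    (X₅ : HMat n₅ q₅) : Prop :=
  σ.A₁ * X₁ - X₂ * σ.B₁ = σ.C₁ ∧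
  σ.A₂ * X₂ - X₃ * σ.B₂ = σ.C₂ ∧
  σ.A₃ * X₃ - X₄ * σ.B₃ = σ.C₃ ∧
  σ.A₄ * X₄ - X₅ * σ.B₄ = σ.C₄

/-- The system has a solution. -/
def Consistent (σ : ChainSystem n₁ n₂ n₃ n₄ n₅ q₁ q₂ q₃ q₄ q₅) : Prop :=
  ∃ X₁ X₂ X₃ X₄ X₅, σ.IsSolution X₁ X₂ X₃ X₄ X₅

/-- The ten rank equalities, one for each string of one, two, three or four consecutive
equations. -/
def RankConditions (σ : ChainSystem n₁ n₂ n₃ n₄ n₅ q₁ q₂ q₃ q₄ q₅) : Prop :=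
  (rank (Matrix.fromBlocks σ.C₁ σ.A₁ σ.B₁ 0) = rank σ.A₁ + rank σ.B₁ ∧
   rank (Matrix.fromBlocks σ.C₂ σ.A₂ σ.B₂ 0) = rank σ.A₂ + rank σ.B₂ ∧
   rank (Matrix.fromBlocks σ.C₃ σ.A₃ σ.B₃ 0) = rank σ.A₃ + rank σ.B₃ ∧
   rank (Matrix.fromBlocks σ.C₄ σ.A₄ σ.B₄ 0) = rank σ.A₄ + rank σ.B₄) ∧
  (rank (Matrix.fromBlocks (σ.A₂ * σ.C₁ + σ.C₂ * σ.B₁) (σ.A₂ * σ.A₁) (σ.B₂ * σ.B₁) 0)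
      = rank (σ.A₂ * σ.A₁) + rank (σ.B₂ * σ.B₁) ∧
   rank (Matrix.fromBlocks (σ.A₃ * σ.C₂ + σ.C₃ * σ.B₂) (σ.A₃ * σ.A₂) (σ.B₃ * σ.B₂) 0)
      = rank (σ.A₃ * σ.A₂) + rank (σ.B₃ * σ.B₂) ∧
   rank (Matrix.fromBlocks (σ.A₄ * σ.C₃ + σ.C₄ * σ.B₃) (σ.A₄ * σ.A₃) (σ.B₄ * σ.B₃) 0)
      = rank (σ.A₄ * σ.A₃) + rank (σ.B₄ * σ.B₃)) ∧
  (rank (Matrix.fromBlocks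
        (σ.A₃ * σ.A₂ * σ.C₁ + σ.A₃ * σ.C₂ * σ.B₁ + σ.C₃ * σ.B₂ * σ.B₁)
        (σ.A₃ * σ.A₂ * σ.A₁) (σ.B₃ * σ.B₂ * σ.B₁) 0)
      = rank (σ.A₃ * σ.A₂ * σ.A₁) + rank (σ.B₃ * σ.B₂ * σ.B₁) ∧
   rank (Matrix.fromBlocks
        (σ.A₄ * σ.A₃ * σ.C₂ + σ.A₄ * σ.C₃ * σ.B₂ + σ.C₄ * σ.B₃ * σ.B₂)
        (σ.A₄ * σ.A₃ * σ.A₂) (σ.B₄ * σ.B₃ * σ.B₂) 0)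
      = rank (σ.A₄ * σ.A₃ * σ.A₂) + rank (σ.B₄ * σ.B₃ * σ.B₂)) ∧
  rank (Matrix.fromBlocks
        (σ.A₄ * σ.A₃ * σ.A₂ * σ.C₁ + σ.A₄ * σ.A₃ * σ.C₂ * σ.B₁
          + σ.A₄ * σ.C₃ * σ.B₂ * σ.B₁ + σ.C₄ * σ.B₃ * σ.B₂ * σ.B₁)
        (σ.A₄ * σ.A₃ * σ.A₂ * σ.A₁) (σ.B₄ * σ.B₃ * σ.B₂ * σ.B₁) 0)
      = rank (σ.A₄ * σ.A₃ * σ.A₂ * σ.A₁) + rank (σ.B₄ * σ.B₃ * σ.B₂ * σ.B₁)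

section Auxiliary

variable (σ : ChainSystem n₁ n₂ n₃ n₄ n₅ q₁ q₂ q₃ q₄ q₅)

noncomputable def A₁₁ : HMat n₃ n₂ := projR (σ.A₂ * σ.A₁) * σ.A₂

noncomputable def B₁₁ : HMat q₂ q₂ := projR σ.B₁ * projL σ.B₂

noncomputable def C₁₁ : HMat n₃ q₂ :=
  projR (σ.A₂ * σ.A₁) * (σ.A₂ * projR σ.A₁ * σ.C₁ * pinv σ.B₁ + σ.C₂) * projL σ.B₂

noncomputable def A₂₂ : HMat n₅ n₄ := projR (σ.A₄ * σ.A₃) * σ.A₄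

noncomputable def B₂₂ : HMat q₄ q₄ := projR σ.B₃ * projL σ.B₄

noncomputable def C₂₂ : HMat n₅ q₄ :=
  projR (σ.A₄ * σ.A₃) * (σ.A₄ * projR σ.A₃ * σ.C₃ * pinv σ.B₃ + σ.C₄) * projL σ.B₄

/-- The block row `(A₂A₁, -L_{A₃})`. -/
noncomputable def A₃₃ : Matrix (Fin n₃) (Fin n₁ ⊕ Fin n₃) ℍ[ℝ] :=
  Matrix.fromCols (σ.A₂ * σ.A₁) (-projL σ.A₃)

/-- The block column with blocks `R_{B₂}` and `-B₄B₃`. -/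
noncomputable def B₃₃ : Matrix (Fin q₃ ⊕ Fin q₅) (Fin q₃) ℍ[ℝ] :=
  Matrix.fromRows (projR σ.B₂) (-(σ.B₄ * σ.B₃))

noncomputable def A₄₄ : HMat q₂ q₃ := projR σ.B₁₁ * projR σ.B₁ * pinv σ.B₂

noncomputable def B₄₄ : HMat n₃ n₃ := -projL (σ.A₄ * σ.A₃)

noncomputable def E₁ : HMat n₃ q₃ :=
  pinv σ.A₃ * σ.C₃ + pinv (σ.A₄ * σ.A₃) * σ.C₄ * σ.B₃
    + pinv (σ.A₄ * σ.A₃) * σ.A₄ * projR σ.A₃ * σ.C₃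
    + projR (σ.A₂ * σ.A₁) * σ.C₂ * pinv σ.B₂
    + σ.A₁₁ * projR σ.A₁ * σ.C₁ * pinv σ.B₁ * pinv σ.B₂
    - σ.C₁₁ * pinv σ.B₁₁ * projR σ.B₁ * pinv σ.B₂

noncomputable def A : HMat n₃ n₂ := projR σ.A₃₃ * σ.A₁₁

noncomputable def B : HMat q₂ q₃ := σ.A₄₄ * projL σ.B₃₃

noncomputable def C : HMat n₃ n₃ := projR σ.A₃₃ * σ.B₄₄

noncomputable def D : HMat q₄ q₃ := σ.B₃ * projL σ.B₃₃

noncomputable def E : HMat n₃ q₃ := projR σ.A₃₃ * σ.E₁ * projL σ.B₃₃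

noncomputable def M : HMat n₃ n₃ := projR σ.A * σ.C

noncomputable def N : HMat q₄ q₃ := σ.D * projL σ.B

noncomputable def S : HMat n₃ n₃ := σ.C * projL σ.M

/-- The solvability conditions in terms of projectors. -/
def ProjectorConditions : Prop :=
  (projR σ.A₁ * σ.C₁ * projL σ.B₁ = 0 ∧ projR σ.A₁₁ * σ.C₁₁ = 0 ∧ σ.C₁₁ * projL σ.B₁₁ = 0) ∧
  (projR σ.A₃ * σ.C₃ * projL σ.B₃ = 0 ∧ projR σ.A₂₂ * σ.C₂₂ = 0 ∧ σ.C₂₂ * projL σ.B₂₂ = 0) ∧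
  projR σ.M * projR σ.A * σ.E = 0 ∧ σ.E * projL σ.B * projL σ.N = 0 ∧
  projR σ.A * σ.E * projL σ.D = 0 ∧ projR σ.C * σ.E * projL σ.B = 0

variable (p : ChainParams n₁ n₂ n₃ n₄ n₅ q₁ q₂ q₃ q₄ q₅)

noncomputable def W₃ : HMat n₂ q₂ :=
  pinv σ.A * σ.E * pinv σ.B - pinv σ.A * σ.C * pinv σ.M * σ.E * pinv σ.B
    - pinv σ.A * σ.S * pinv σ.C * σ.E * pinv σ.N * σ.D * pinv σ.B
    - pinv σ.A * σ.S * p.Z₁ * projR σ.N * σ.D * pinv σ.B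
    + projL σ.A * p.Z₂ + p.Z₃ * projR σ.B

noncomputable def T₆ : HMat n₃ q₄ :=
  pinv σ.M * σ.E * pinv σ.D + pinv σ.S * σ.S * pinv σ.C * σ.E * pinv σ.N
    + projL σ.M * projL σ.S * p.Z₄ + projL σ.M * p.Z₁ * projR σ.N + p.Z₅ * projR σ.D

/-- The block column with blocks `W₄` and `T₁`. -/
noncomputable def colW₄T₁ : Matrix (Fin n₁ ⊕ Fin n₃) (Fin q₃) ℍ[ℝ] :=
  pinv σ.A₃₃ * (σ.E₁ - σ.A₁₁ * σ.W₃ p * σ.A₄₄ - σ.B₄₄ * σ.T₆ p * σ.B₃)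
    - pinv σ.A₃₃ * p.Z₇ * σ.B₃₃ + projL σ.A₃₃ * p.Z₆

/-- The block row `(W₅, T₄)`. -/
noncomputable def rowW₅T₄ : Matrix (Fin n₃) (Fin q₃ ⊕ Fin q₅) ℍ[ℝ] :=
  projR σ.A₃₃ * (σ.E₁ - σ.A₁₁ * σ.W₃ p * σ.A₄₄ - σ.B₄₄ * σ.T₆ p * σ.B₃) * pinv σ.B₃₃
    + σ.A₃₃ * pinv σ.A₃₃ * p.Z₇ + p.Z₈ * projR σ.B₃₃

/-- `W₄ = (I, 0) [⋯]`: the first block of rows. -/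
noncomputable def W₄ : HMat n₁ q₃ := (σ.colW₄T₁ p).toRows₁

/-- `T₁ = (0, I) [⋯]`: the second block of rows. -/
noncomputable def T₁ : HMat n₃ q₃ := (σ.colW₄T₁ p).toRows₂

/-- `W₅ = [⋯] (I, 0)ᵀ`: the first block of columns. -/
noncomputable def W₅ : HMat n₃ q₃ := (σ.rowW₅T₄ p).toCols₁

/-- `T₄ = [⋯] (0, I)ᵀ`: the second block of columns. -/
noncomputable def T₄ : HMat n₃ q₅ := (σ.rowW₅T₄ p).toCols₂

noncomputable def V₁ : HMat n₂ q₂ :=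
  pinv σ.A₁₁ * σ.C₁₁ * pinv σ.B₁₁ + projL σ.A₁₁ * p.W₂ + σ.W₃ p * projR σ.B₁₁

noncomputable def U₁ : HMat n₁ q₂ :=
  pinv (σ.A₂ * σ.A₁)
      * (σ.C₂ + σ.A₂ * projR σ.A₁ * σ.C₁ * pinv σ.B₁ - σ.A₂ * σ.V₁ p * projR σ.B₁)
    + σ.W₄ p * σ.B₂ + projL (σ.A₂ * σ.A₁) * p.W₆

noncomputable def V₂ : HMat n₄ q₄ :=
  pinv σ.A₂₂ * σ.C₂₂ * pinv σ.B₂₂ + projL σ.A₂₂ * p.T₂ + p.T₃ * projR σ.B₂₂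

noncomputable def U₂ : HMat n₃ q₄ :=
  pinv (σ.A₄ * σ.A₃)
      * (σ.C₄ + σ.A₄ * projR σ.A₃ * σ.C₃ * pinv σ.B₃ - σ.A₄ * σ.V₂ p * projR σ.B₃)
    + σ.T₄ p * σ.B₄ + projL (σ.A₄ * σ.A₃) * σ.T₆ p

noncomputable def solX₁ : HMat n₁ q₁ :=
  pinv σ.A₁ * σ.C₁ + σ.U₁ p * σ.B₁ + projL σ.A₁ * p.W₁

noncomputable def solX₂ : HMat n₂ q₂ :=
  -(projR σ.A₁ * σ.C₁ * pinv σ.B₁) + σ.A₁ * σ.U₁ p + σ.V₁ p * projR σ.B₁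

noncomputable def solX₃ : HMat n₃ q₃ :=
  pinv σ.A₃ * σ.C₃ + σ.U₂ p * σ.B₃ + projL σ.A₃ * σ.T₁ p

/-- The second expression for `X₃`. -/
noncomputable def solX₃' : HMat n₃ q₃ :=
  -(projR (σ.A₂ * σ.A₁) * σ.C₂ * pinv σ.B₂)
    - σ.A₁₁ * projR σ.A₁ * σ.C₁ * pinv σ.B₁ * pinv σ.B₂
    + σ.C₁₁ * pinv σ.B₁₁ * projR σ.B₁ * pinv σ.B₂
    + σ.A₁₁ * σ.W₃ p * σ.A₄₄ + σ.A₂ * σ.A₁ * σ.W₄ p + σ.W₅ p * projR σ.B₂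

/-- The third expression for `X₃`. -/
noncomputable def solX₃'' : HMat n₃ q₃ :=
  pinv σ.A₃ * σ.C₃ + pinv (σ.A₄ * σ.A₃) * σ.C₄ * σ.B₃
    + pinv (σ.A₄ * σ.A₃) * σ.A₄ * projR σ.A₃ * σ.C₃
    + projL σ.A₃ * σ.T₁ p + σ.T₄ p * σ.B₄ * σ.B₃ + projL (σ.A₄ * σ.A₃) * σ.T₆ p * σ.B₃

noncomputable def solX₄ : HMat n₄ q₄ :=
  -(projR σ.A₃ * σ.C₃ * pinv σ.B₃) + σ.A₃ * σ.U₂ p + σ.V₂ p * projR σ.B₃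

noncomputable def solX₅ : HMat n₅ q₅ :=
  -(projR (σ.A₄ * σ.A₃)
      * (σ.C₄ + σ.A₄ * projR σ.A₃ * σ.C₃ * pinv σ.B₃ - σ.A₄ * σ.V₂ p * projR σ.B₃)
      * pinv σ.B₄)
    + σ.A₄ * σ.A₃ * σ.T₄ p + p.T₅ * projR σ.B₄

end Auxiliary

end ChainSystem

/-! Everything reduces to `R_A C L_B = 0`, which says that `C` maps the kernel of `B` into the range
of `A`. This is the solvability criterion for `A X - Y B = C`, and by
`rank_fromBlocks_zero_eq_add_iff` it is also the rank equality for the block matrix with blocks `C,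
A, B, 0`. The implication (1) → (2) is then telescoping: a string of consecutive equations collapses
to one equation of this form.

For (2) → (1) the unknowns are built one after another, with no use of the projector formulas. Once
`X₁` is chosen, `X₂` is forced on the range of `B₁` and free elsewhere, and so on down the chain.
Each unknown must therefore be chosen with the whole remainder of the chain in view: it has to
satisfy every telescoped equation starting at its index, each on the kernel of the corresponding
product of `B`s. These kernels are nested. `exists_extend` adjusts a matrix on one kernel while
keeping it on a given range, `exists_extend_flag` climbs the flag, and `telescope_step` passes the
compatibility conditions to the next unknown.

For (3) and the general solution the chain is cut at `X₃`. Each half is solved by `two_step_eq_iff`,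
whose only internal obstruction is an equation `A₁₁ V B₁₁ = C₁₁`. Equating the two resulting
formulas for `X₃` gives an equation `A₃₃ P + Q B₃₃ = …`, whose solvability condition is the two-term
equation `A W₃ B + C T₆ D = E`, solved in `two_term_eq_iff`. The rank and projector conditions are
never compared directly; both are shown equivalent to consistency. -/

set_option linter.unusedSectionVars false

namespace QMatrix

/-! ### Projector identities and one-term linear matrix equations. -/

section PinvAlgebra

variable {l m n o : Type*} [Fintype l] [Fintype m] [Fintype n] [Fintype o]
  [DecidableEq l] [DecidableEq m] [DecidableEq n] [DecidableEq o]

theorem mul_projL (A : Matrix m n ℍ[ℝ]) : A * projL A = 0 := by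
  rw [projL, Matrix.mul_sub, Matrix.mul_one, ← Matrix.mul_assoc, (pinv_spec A).mul_mul_self,
    sub_self]

theorem projR_mul (A : Matrix m n ℍ[ℝ]) : projR A * A = 0 := by
  rw [projR, Matrix.sub_mul, Matrix.one_mul, (pinv_spec A).mul_mul_self, sub_self]

theorem conjTranspose_projL (A : Matrix m n ℍ[ℝ]) : (projL A)ᴴ = projL A := by
  rw [projL, Matrix.conjTranspose_sub, (pinv_spec A).right_herm, Matrix.conjTranspose_one]

theorem conjTranspose_projR (A : Matrix m n ℍ[ℝ]) : (projR A)ᴴ = projR A := by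
  rw [projR, Matrix.conjTranspose_sub, (pinv_spec A).left_herm, Matrix.conjTranspose_one]

theorem pinv_mul_self (A : Matrix m n ℍ[ℝ]) : pinv A * A = 1 - projL A := by
  rw [projL, sub_sub_cancel]

theorem mul_pinv_self (A : Matrix m n ℍ[ℝ]) : A * pinv A = 1 - projR A := by
  rw [projR, sub_sub_cancel]

theorem projL_mul_projL (A : Matrix m n ℍ[ℝ]) : projL A * projL A = projL A := by
  conv_lhs => rw [projL, Matrix.sub_mul, Matrix.mul_assoc, ← projL, mul_projL]
  simp

theorem projR_mul_projR (A : Matrix m n ℍ[ℝ]) : projR A * projR A = projR A := by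
  conv_lhs => rw [projR, Matrix.mul_sub, ← Matrix.mul_assoc, ← projR, projR_mul]
  simp

/-- If `C` is killed by `R_A` on the left then `A A† C = C`. -/
theorem mul_pinv_mul_of_projR {A : Matrix m n ℍ[ℝ]} {C : Matrix m l ℍ[ℝ]}
    (h : projR A * C = 0) : A * (pinv A * C) = C := by
  rw [projR, Matrix.sub_mul, Matrix.one_mul, sub_eq_zero, Matrix.mul_assoc] at h
  exact h.symm

theorem mul_pinv_mul_of_projL {B : Matrix m n ℍ[ℝ]} {C : Matrix l n ℍ[ℝ]}
    (h : C * projL B = 0) : C * pinv B * B = C := by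
  rw [projL, Matrix.mul_sub, Matrix.mul_one, sub_eq_zero, ← Matrix.mul_assoc] at h
  exact h.symm

theorem projL_mul_of_mul_eq_zero {B : Matrix m n ℍ[ℝ]} {Y : Matrix n l ℍ[ℝ]}
    (h : B * Y = 0) : projL B * Y = Y := by
  rw [projL, Matrix.sub_mul, Matrix.mul_assoc, h]; simp

/-- A Hermitian matrix fixing `M` on the left fixes `M†` on the right. -/
theorem pinv_mul_of_herm {M : Matrix m n ℍ[ℝ]} {P : Matrix m m ℍ[ℝ]} (hP : Pᴴ = P)
    (h : P * M = M) : pinv M * P = pinv M := by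
  have h1 : M * pinv M * P = M * pinv M := by
    calc M * pinv M * P = (P * M * pinv M)ᴴ := by
          rw [Matrix.mul_assoc P, Matrix.conjTranspose_mul, (pinv_spec M).left_herm, hP]
      _ = M * pinv M := by rw [h, (pinv_spec M).left_herm]
  calc pinv M * P = pinv M * M * pinv M * P := by rw [(pinv_spec M).self_mul_mul]
    _ = pinv M * (M * pinv M * P) := by simp only [Matrix.mul_assoc]
    _ = pinv M := by rw [h1, ← Matrix.mul_assoc, (pinv_spec M).self_mul_mul]

/-- A Hermitian matrix fixing `M` on the right fixes `M†` on the left. -/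
theorem mul_pinv_of_herm {M : Matrix m n ℍ[ℝ]} {P : Matrix n n ℍ[ℝ]} (hP : Pᴴ = P)
    (h : M * P = M) : P * pinv M = pinv M := by
  have h1 : P * (pinv M * M) = pinv M * M := by
    calc P * (pinv M * M) = (pinv M * (M * P))ᴴ := by
          rw [← Matrix.mul_assoc (pinv M), Matrix.conjTranspose_mul, (pinv_spec M).right_herm, hP]
      _ = pinv M * M := by rw [h, (pinv_spec M).right_herm]
  calc P * pinv M = P * (pinv M * M * pinv M) := by rw [(pinv_spec M).self_mul_mul]
    _ = P * (pinv M * M) * pinv M := by simp only [Matrix.mul_assoc]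
    _ = pinv M := by rw [h1, (pinv_spec M).self_mul_mul]

theorem pinv_projR_mul (A : Matrix m n ℍ[ℝ]) (C : Matrix m o ℍ[ℝ]) :
    pinv (projR A * C) * projR A = pinv (projR A * C) :=
  pinv_mul_of_herm (conjTranspose_projR A) (by rw [← Matrix.mul_assoc, projR_mul_projR])

theorem projL_mul_pinv_mul (B : Matrix m n ℍ[ℝ]) (D : Matrix o n ℍ[ℝ]) :
    projL B * pinv (D * projL B) = pinv (D * projL B) :=
  mul_pinv_of_herm (conjTranspose_projL B) (by rw [Matrix.mul_assoc, projL_mul_projL])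

/-! ### The equation `A X - Y B = C` -/

theorem projR_mul_mul_projL_of_sub {A : Matrix m n ℍ[ℝ]} {B : Matrix o l ℍ[ℝ]}
    {C : Matrix m l ℍ[ℝ]} {X : Matrix n l ℍ[ℝ]} {Y : Matrix m o ℍ[ℝ]}
    (h : A * X - Y * B = C) : projR A * C * projL B = 0 := by
  have h1 : projR A * (A * X) = 0 := by rw [← Matrix.mul_assoc, projR_mul, Matrix.zero_mul]
  rw [← h, Matrix.mul_sub, h1, zero_sub, Matrix.neg_mul, Matrix.mul_assoc, Matrix.mul_assoc,
    mul_projL, Matrix.mul_zero, Matrix.mul_zero, neg_zero]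

/-- A given solution is recovered from the formula by the parameters `U = A† Y`, `V = R_A Y`, `W =
X`. Conversely, the condition `h` is what makes `R_A C B† B` collapse to `R_A C`. The two equations
treated next follow the same pattern. -/
theorem mul_sub_mul_eq_iff {A : Matrix m n ℍ[ℝ]} {B : Matrix o l ℍ[ℝ]} {C : Matrix m l ℍ[ℝ]}
    (h : projR A * C * projL B = 0) (X : Matrix n l ℍ[ℝ]) (Y : Matrix m o ℍ[ℝ]) :
    A * X - Y * B = C ↔ ∃ (U : Matrix n o ℍ[ℝ]) (V : Matrix m o ℍ[ℝ]) (W : Matrix n l ℍ[ℝ]),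
      X = pinv A * C + U * B + projL A * W ∧
      Y = -(projR A * C * pinv B) + A * U + V * projR B := by
  constructor
  · intro hXY
    refine ⟨pinv A * Y, projR A * Y, X, ?_, ?_⟩
    · rw [← hXY, projL]
      simp only [Matrix.mul_sub, Matrix.sub_mul, Matrix.one_mul, Matrix.mul_assoc]
      abel
    · have h1 : projR A * C = -(projR A * Y * B) := by
        rw [← hXY, Matrix.mul_sub, ← Matrix.mul_assoc, projR_mul, Matrix.zero_mul, zero_sub,
          Matrix.mul_assoc]
      rw [h1, Matrix.neg_mul, neg_neg, projR, projR]
      simp only [Matrix.mul_sub, Matrix.sub_mul, Matrix.one_mul, Matrix.mul_one, Matrix.mul_assoc]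
      abel
  · rintro ⟨U, V, W, rfl, rfl⟩
    have h1 := mul_pinv_mul_of_projL h
    have h2 : A * (projL A * W) = 0 := by rw [← Matrix.mul_assoc, mul_projL, Matrix.zero_mul]
    have h3 : V * projR B * B = 0 := by rw [Matrix.mul_assoc, projR_mul, Matrix.mul_zero]
    rw [Matrix.mul_add, Matrix.mul_add, h2, Matrix.add_mul, Matrix.add_mul, h3, Matrix.neg_mul, h1,
      ← Matrix.mul_assoc, mul_pinv_self, ← Matrix.mul_assoc, Matrix.sub_mul, Matrix.one_mul]
    abel

/-! ### The equation `A X + Y B = C` -/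

theorem projR_mul_mul_projL_of_add {A : Matrix m n ℍ[ℝ]} {B : Matrix o l ℍ[ℝ]}
    {C : Matrix m l ℍ[ℝ]} {X : Matrix n l ℍ[ℝ]} {Y : Matrix m o ℍ[ℝ]}
    (h : A * X + Y * B = C) : projR A * C * projL B = 0 :=
  projR_mul_mul_projL_of_sub (X := X) (Y := -Y) (by rw [Matrix.neg_mul, sub_neg_eq_add, h])

theorem mul_add_mul_eq_iff {A : Matrix m n ℍ[ℝ]} {B : Matrix o l ℍ[ℝ]} {C : Matrix m l ℍ[ℝ]}
    (h : projR A * C * projL B = 0) (X : Matrix n l ℍ[ℝ]) (Y : Matrix m o ℍ[ℝ]) :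
    A * X + Y * B = C ↔ ∃ (Z : Matrix n l ℍ[ℝ]) (V V' : Matrix m o ℍ[ℝ]),
      X = pinv A * C - pinv A * V * B + projL A * Z ∧
      Y = projR A * C * pinv B + A * pinv A * V + V' * projR B := by
  constructor
  · intro hXY
    refine ⟨X, Y, projR A * Y, ?_, ?_⟩
    · rw [← hXY, projL]
      simp only [Matrix.mul_add, Matrix.sub_mul, Matrix.one_mul, Matrix.mul_assoc]
      abel
    · have h1 : projR A * C = projR A * Y * B := by
        rw [← hXY, Matrix.mul_add, ← Matrix.mul_assoc, projR_mul, Matrix.zero_mul, zero_add,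
          Matrix.mul_assoc]
      rw [h1, projR, projR]
      simp only [Matrix.mul_sub, Matrix.sub_mul, Matrix.one_mul, Matrix.mul_one, Matrix.mul_assoc]
      abel
  · rintro ⟨Z, V, V', rfl, rfl⟩
    have h1 := mul_pinv_mul_of_projL h
    have h2 : A * (projL A * Z) = 0 := by rw [← Matrix.mul_assoc, mul_projL, Matrix.zero_mul]
    have h3 : V' * projR B * B = 0 := by rw [Matrix.mul_assoc, projR_mul, Matrix.mul_zero]
    rw [Matrix.mul_add, Matrix.mul_sub, h2, Matrix.add_mul, Matrix.add_mul, h3, h1, projR]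
    simp only [Matrix.sub_mul, Matrix.one_mul, Matrix.mul_assoc]
    abel

/-! ### The equation `A V B = C` -/

theorem projR_mul_of_mul_mul {A : Matrix m n ℍ[ℝ]} {B : Matrix o l ℍ[ℝ]} {C : Matrix m l ℍ[ℝ]}
    {V : Matrix n o ℍ[ℝ]} (h : A * V * B = C) : projR A * C = 0 := by
  rw [← h, ← Matrix.mul_assoc, ← Matrix.mul_assoc, projR_mul, Matrix.zero_mul, Matrix.zero_mul]

theorem mul_projL_of_mul_mul {A : Matrix m n ℍ[ℝ]} {B : Matrix o l ℍ[ℝ]} {C : Matrix m l ℍ[ℝ]}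
    {V : Matrix n o ℍ[ℝ]} (h : A * V * B = C) : C * projL B = 0 := by
  rw [← h, Matrix.mul_assoc, mul_projL, Matrix.mul_zero]

theorem mul_mul_eq_iff {A : Matrix m n ℍ[ℝ]} {B : Matrix o l ℍ[ℝ]} {C : Matrix m l ℍ[ℝ]}
    (h₁ : projR A * C = 0) (h₂ : C * projL B = 0) (V : Matrix n o ℍ[ℝ]) :
    A * V * B = C ↔ ∃ W W' : Matrix n o ℍ[ℝ],
      V = pinv A * C * pinv B + projL A * W + W' * projR B := by
  constructor
  · intro h
    refine ⟨V, pinv A * A * V, ?_⟩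
    rw [← h, projL, projR]
    simp only [Matrix.mul_sub, Matrix.sub_mul, Matrix.one_mul, Matrix.mul_one, Matrix.mul_assoc]
    abel
  · rintro ⟨W, W', rfl⟩
    have h3 : A * (projL A * W) = 0 := by rw [← Matrix.mul_assoc, mul_projL, Matrix.zero_mul]
    have h4 : A * (W' * projR B) * B = 0 := by
      rw [← Matrix.mul_assoc, Matrix.mul_assoc, projR_mul, Matrix.mul_zero]
    rw [Matrix.mul_add, Matrix.mul_add, h3, add_zero, Matrix.add_mul, h4, add_zero,
      Matrix.mul_assoc (pinv A), mul_pinv_mul_of_projR, mul_pinv_mul_of_projL h₂]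
    rw [← Matrix.mul_assoc, h₁, Matrix.zero_mul]

end PinvAlgebra

/-! ### The two-term equation in two unknowns. -/

section TwoTerm

variable {m n o r s t : Type*} [Fintype m] [Fintype n] [Fintype o] [Fintype r] [Fintype s]
  [Fintype t] [DecidableEq m] [DecidableEq n] [DecidableEq o] [DecidableEq r] [DecidableEq s]
  [DecidableEq t]

/-! ### The equation `A X B + C Y D = E` -/

variable {A : Matrix m n ℍ[ℝ]} {B : Matrix o r ℍ[ℝ]} {C : Matrix m s ℍ[ℝ]} {D : Matrix t r ℍ[ℝ]}
  {E : Matrix m r ℍ[ℝ]}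

theorem projR_mul_mul_of_add {X : Matrix n o ℍ[ℝ]} {Y : Matrix s t ℍ[ℝ]}
    (h : A * X * B + C * Y * D = E) : projR A * C * Y * D = projR A * E := by
  rw [← h, Matrix.mul_add, ← Matrix.mul_assoc, ← Matrix.mul_assoc, projR_mul]
  simp only [Matrix.zero_mul, zero_add, Matrix.mul_assoc]

theorem mul_mul_projL_of_add {X : Matrix n o ℍ[ℝ]} {Y : Matrix s t ℍ[ℝ]}
    (h : A * X * B + C * Y * D = E) : C * Y * (D * projL B) = E * projL B := by
  rw [← h, Matrix.add_mul, Matrix.mul_assoc (A * X), mul_projL]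
  simp only [Matrix.mul_zero, zero_add, Matrix.mul_assoc]

/-- For fixed `Y` this is an equation `A X B = E - C Y D` in `X`. Its two solvability conditions, on
the left by `R_A` and on the right by `L_B`, become a pair of equations in `Y` alone. -/
theorem mul_mul_add_mul_mul_eq_iff (X : Matrix n o ℍ[ℝ]) (Y : Matrix s t ℍ[ℝ]) :
    A * X * B + C * Y * D = E ↔
      (projR A * C * Y * D = projR A * E ∧ C * Y * (D * projL B) = E * projL B) ∧
      ∃ Z Z' : Matrix n o ℍ[ℝ],
        X = pinv A * (E - C * Y * D) * pinv B + projL A * Z + Z' * projR B := by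
  constructor
  · intro h
    refine ⟨⟨projR_mul_mul_of_add h, mul_mul_projL_of_add h⟩, ?_⟩
    have h' : A * X * B = E - C * Y * D := by rw [← h, add_sub_cancel_right]
    exact (mul_mul_eq_iff (projR_mul_of_mul_mul h') (mul_projL_of_mul_mul h') X).1 h'
  · rintro ⟨⟨h1, h2⟩, hX⟩
    have h' := (mul_mul_eq_iff (A := A) (B := B) (C := E - C * Y * D)
      (by rw [Matrix.mul_sub, ← h1]; simp only [Matrix.mul_assoc, sub_self])
      (by rw [Matrix.sub_mul, ← h2]; simp only [Matrix.mul_assoc, sub_self]) X).2 hX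
    rw [h', sub_add_cancel]

/-- With `M = R_A C`, `N = D L_B`, `S = C L_M`, the first equation gives `Y = M† E D† + L_M G + H
R_D`. Inserted in the second, the `H` term dies because `R_D N = 0`, and an equation `S G N = …`
remains for `G`. -/
theorem pair_eq_iff (h₁ : projR (projR A * C) * projR A * E = 0)
    (h₂ : E * projL B * projL (D * projL B) = 0) (h₃ : projR A * E * projL D = 0)
    (h₄ : projR C * E * projL B = 0) (Y : Matrix s t ℍ[ℝ]) :
    (projR A * C * Y * D = projR A * E ∧ C * Y * (D * projL B) = E * projL B) ↔
      ∃ Z₁ Z₄ Z₅ : Matrix s t ℍ[ℝ],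
        Y = pinv (projR A * C) * E * pinv D
          + pinv (C * projL (projR A * C)) * (C * projL (projR A * C)) * pinv C * E
            * pinv (D * projL B)
          + projL (projR A * C) * projL (C * projL (projR A * C)) * Z₄
          + projL (projR A * C) * Z₁ * projR (D * projL B) + Z₅ * projR D := by
  have hM : pinv (projR A * C) * projR A = pinv (projR A * C) := pinv_projR_mul A C
  have hMC : pinv (projR A * C) * C = 1 - projL (projR A * C) := by
    rw [← pinv_mul_self, ← Matrix.mul_assoc, hM]
  have hN : projL B * pinv (D * projL B) = pinv (D * projL B) := projL_mul_pinv_mul B D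
  have hS : projL (projR A * C) * pinv (C * projL (projR A * C))
      = pinv (C * projL (projR A * C)) := projL_mul_pinv_mul _ _
  generalize hMdef : projR A * C = M at *
  generalize hNdef : D * projL B = N at *
  generalize hSdef : C * projL M = S at *
  have hDN : projR D * N = 0 := by rw [← hNdef, ← Matrix.mul_assoc, projR_mul, Matrix.zero_mul]
  have hMED : pinv M * E * pinv D * D = pinv M * E := by
    apply mul_pinv_mul_of_projL
    rw [← hM, Matrix.mul_assoc (pinv M), Matrix.mul_assoc, h₃, Matrix.mul_zero]
  have hMEDN : pinv M * E * pinv D * N = pinv M * E * projL B := by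
    rw [← hNdef, ← Matrix.mul_assoc, hMED]
  have hCC : C * (pinv C * (E * projL B)) = E * projL B :=
    mul_pinv_mul_of_projR (by rw [← Matrix.mul_assoc, h₄])
  -- The right side of the equation for `G` visibly lies in the range of `S`: write `E L_B = C C† E
  -- L_B`, then use `M† C = I - L_M`.
  have hrhs : E * projL B - C * (pinv M * E * projL B) = S * (pinv C * (E * projL B)) := by
    have : pinv M * E * projL B = (1 - projL M) * (pinv C * (E * projL B)) := by
      rw [← hMC, Matrix.mul_assoc (pinv M) C, hCC, Matrix.mul_assoc]
    rw [this, Matrix.sub_mul, Matrix.one_mul, Matrix.mul_sub, hCC, ← hSdef, Matrix.mul_assoc,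
      sub_sub_cancel]
  have hfirst : (M * Y * D = projR A * E) ↔ ∃ G H : Matrix s t ℍ[ℝ],
      Y = pinv M * E * pinv D + projL M * G + H * projR D := by
    rw [mul_mul_eq_iff (by rw [← Matrix.mul_assoc, h₁]) h₃, ← Matrix.mul_assoc, hM]
  have hsecond : ∀ G : Matrix s t ℍ[ℝ], (S * G * N = S * (pinv C * (E * projL B))) ↔
      ∃ Z₄ Z₁ : Matrix s t ℍ[ℝ],
        G = pinv S * S * pinv C * E * pinv N + projL S * Z₄ + Z₁ * projR N := by
    intro G
    rw [mul_mul_eq_iff]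
    · simp only [Matrix.mul_assoc, hN]
    · rw [← Matrix.mul_assoc, projR_mul, Matrix.zero_mul]
    · simp only [Matrix.mul_assoc] at h₂ ⊢
      simp only [h₂, Matrix.mul_zero]
  have hCY : ∀ G H : Matrix s t ℍ[ℝ], C * (pinv M * E * pinv D + projL M * G + H * projR D) * N
      = C * (pinv M * E * projL B) + S * G * N := by
    intro G H
    rw [Matrix.mul_assoc, Matrix.add_mul, Matrix.add_mul, hMEDN, Matrix.mul_assoc H, hDN,
      Matrix.mul_zero, add_zero, Matrix.mul_add, ← hSdef]
    simp only [Matrix.mul_assoc]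
  rw [hfirst]
  constructor
  · rintro ⟨⟨G, H, rfl⟩, h⟩
    rw [hCY, ← eq_sub_iff_add_eq', hrhs, hsecond] at h
    obtain ⟨Z₄, Z₁, rfl⟩ := h
    refine ⟨Z₁, Z₄, H, ?_⟩
    rw [Matrix.mul_add, Matrix.mul_add]
    simp only [← Matrix.mul_assoc, hS]
    abel
  · rintro ⟨Z₁, Z₄, Z₅, hY⟩
    have hY' : Y = pinv M * E * pinv D + projL M *
        (pinv S * S * pinv C * E * pinv N + projL S * Z₄ + Z₁ * projR N) + Z₅ * projR D := by
      rw [hY, Matrix.mul_add, Matrix.mul_add]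
      simp only [← Matrix.mul_assoc, hS]
      abel
    refine ⟨⟨_, _, hY'⟩, ?_⟩
    rw [hY', hCY, ← eq_sub_iff_add_eq', hrhs, hsecond]
    exact ⟨_, _, rfl⟩

theorem two_term_necessary {X : Matrix n o ℍ[ℝ]} {Y : Matrix s t ℍ[ℝ]}
    (h : A * X * B + C * Y * D = E) :
    projR (projR A * C) * projR A * E = 0 ∧ E * projL B * projL (D * projL B) = 0 ∧
      projR A * E * projL D = 0 ∧ projR C * E * projL B = 0 := by
  have h1 := projR_mul_mul_of_add h
  have h2 := mul_mul_projL_of_add h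
  refine ⟨?_, mul_projL_of_mul_mul h2, mul_projL_of_mul_mul h1, ?_⟩
  · rw [Matrix.mul_assoc]; exact projR_mul_of_mul_mul h1
  · rw [Matrix.mul_assoc]; exact projR_mul_of_mul_mul h2

theorem two_term_eq_iff (h₁ : projR (projR A * C) * projR A * E = 0)
    (h₂ : E * projL B * projL (D * projL B) = 0) (h₃ : projR A * E * projL D = 0)
    (h₄ : projR C * E * projL B = 0) (X : Matrix n o ℍ[ℝ]) (Y : Matrix s t ℍ[ℝ]) :
    A * X * B + C * Y * D = E ↔
      ∃ (Z₁ : Matrix s t ℍ[ℝ]) (Z₂ Z₃ : Matrix n o ℍ[ℝ]) (Z₄ Z₅ : Matrix s t ℍ[ℝ]),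
        X = pinv A * E * pinv B - pinv A * C * pinv (projR A * C) * E * pinv B
          - pinv A * (C * projL (projR A * C)) * pinv C * E * pinv (D * projL B) * D * pinv B
          - pinv A * (C * projL (projR A * C)) * Z₁ * projR (D * projL B) * D * pinv B
          + projL A * Z₂ + Z₃ * projR B ∧
        Y = pinv (projR A * C) * E * pinv D
          + pinv (C * projL (projR A * C)) * (C * projL (projR A * C)) * pinv C * E
            * pinv (D * projL B)
          + projL (projR A * C) * projL (C * projL (projR A * C)) * Z₄
          + projL (projR A * C) * Z₁ * projR (D * projL B) + Z₅ * projR D := by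
  rw [mul_mul_add_mul_mul_eq_iff, pair_eq_iff h₁ h₂ h₃ h₄]
  have hM : pinv (projR A * C) * projR A = pinv (projR A * C) := pinv_projR_mul A C
  have hS : projL (projR A * C) * pinv (C * projL (projR A * C))
      = pinv (C * projL (projR A * C)) := projL_mul_pinv_mul _ _
  generalize projR A * C = M at *
  have hCS : C * pinv (C * projL M) = C * projL M * pinv (C * projL M) := by
    rw [Matrix.mul_assoc, hS]
  generalize hSdef : C * projL M = S at *
  generalize hNdef : D * projL B = N at *
  have hMED : pinv M * E * pinv D * D = pinv M * E := by
    apply mul_pinv_mul_of_projL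
    rw [← hM, Matrix.mul_assoc (pinv M), Matrix.mul_assoc, h₃, Matrix.mul_zero]
  -- In `C Y D` the parameters `Z₄` and `Z₅` cancel, since `C L_M L_S = S L_S = 0` and `R_D D = 0`.
  -- Only `Z₁` survives, so it is the one parameter shared by `X` and `Y`.
  have key : ∀ Z₁ Z₄ Z₅ : Matrix s t ℍ[ℝ],
      C * (pinv M * E * pinv D + pinv S * S * pinv C * E * pinv N
        + projL M * projL S * Z₄ + projL M * Z₁ * projR N + Z₅ * projR D) * D
      = C * pinv M * E + S * pinv C * E * pinv N * D + S * Z₁ * projR N * D := by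
    intro Z₁ Z₄ Z₅
    have e1 : C * (pinv M * E * pinv D) * D = C * pinv M * E := by
      rw [Matrix.mul_assoc, hMED, Matrix.mul_assoc]
    have e2 : C * (pinv S * S * pinv C * E * pinv N) * D = S * pinv C * E * pinv N * D := by
      simp only [← Matrix.mul_assoc, hCS, (pinv_spec S).mul_mul_self]
    have e3 : C * (projL M * projL S * Z₄) * D = 0 := by
      simp only [← Matrix.mul_assoc, hSdef, mul_projL, Matrix.zero_mul]
    have e4 : C * (projL M * Z₁ * projR N) * D = S * Z₁ * projR N * D := by
      simp only [← Matrix.mul_assoc, hSdef]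
    have e5 : C * (Z₅ * projR D) * D = 0 := by
      simp only [Matrix.mul_assoc, projR_mul, Matrix.mul_zero]
    simp only [Matrix.mul_add, Matrix.add_mul, e1, e2, e3, e4, e5, add_zero]
  have key2 : ∀ Z₁ Z₄ Z₅ : Matrix s t ℍ[ℝ],
      pinv A * (E - C * (pinv M * E * pinv D + pinv S * S * pinv C * E * pinv N
        + projL M * projL S * Z₄ + projL M * Z₁ * projR N + Z₅ * projR D) * D) * pinv B
      = pinv A * E * pinv B - pinv A * C * pinv M * E * pinv B
          - pinv A * S * pinv C * E * pinv N * D * pinv B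
          - pinv A * S * Z₁ * projR N * D * pinv B := by
    intro Z₁ Z₄ Z₅
    rw [key]
    simp only [Matrix.mul_sub, Matrix.sub_mul, Matrix.mul_add, Matrix.add_mul, ← Matrix.mul_assoc]
    abel
  constructor
  · rintro ⟨⟨Z₁, Z₄, Z₅, rfl⟩, Z₂, Z₃, rfl⟩
    exact ⟨Z₁, Z₂, Z₃, Z₄, Z₅, by rw [key2], rfl⟩
  · rintro ⟨Z₁, Z₂, Z₃, Z₄, Z₅, rfl, rfl⟩
    exact ⟨⟨Z₁, Z₄, Z₅, rfl⟩, Z₂, Z₃, by rw [key2]⟩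

end TwoTerm

end QMatrix

namespace QMatrix

/-! ### Rank equalities as projector equations. -/

section Rank

variable {m n o l : Type*} [Fintype m] [Fintype n] [Fintype o] [Fintype l]
  [DecidableEq m] [DecidableEq n] [DecidableEq o] [DecidableEq l]

/-- Column spaces are right vector spaces, so the dimension arguments need finiteness over the
opposite ring; `1` generates. -/
instance finite_mulOpposite : Module.Finite ℍ[ℝ]ᵐᵒᵖ ℍ[ℝ] :=
  Module.Finite.of_surjective (LinearMap.toSpanSingleton ℍ[ℝ]ᵐᵒᵖ ℍ[ℝ] 1)
    fun x => ⟨MulOpposite.op x, by simp⟩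

/-- The right-linear map of column vectors given by a matrix. -/
def lin (A : Matrix m n ℍ[ℝ]) : (n → ℍ[ℝ]) →ₗ[ℍ[ℝ]ᵐᵒᵖ] (m → ℍ[ℝ]) where
  toFun v := A *ᵥ v
  map_add' := Matrix.mulVec_add A
  map_smul' c v := Matrix.mulVec_smul A c v

theorem lin_apply (A : Matrix m n ℍ[ℝ]) (v : n → ℍ[ℝ]) : lin A v = A *ᵥ v := rfl

theorem span_range_col (A : Matrix m n ℍ[ℝ]) :
    Submodule.span ℍ[ℝ]ᵐᵒᵖ (Set.range A.col) = LinearMap.range (lin A) := by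
  apply le_antisymm
  · rw [Submodule.span_le]
    rintro _ ⟨j, rfl⟩
    exact ⟨Pi.single j 1, by rw [lin_apply, Matrix.mulVec_single_one]⟩
  · rintro _ ⟨v, rfl⟩
    rw [lin_apply, Matrix.mulVec_eq_sum]
    exact Submodule.sum_mem _ fun j _ =>
      Submodule.smul_mem _ _ (Submodule.subset_span ⟨j, rfl⟩)

theorem rank_eq_finrank_range (A : Matrix m n ℍ[ℝ]) :
    rank A = Module.finrank ℍ[ℝ]ᵐᵒᵖ (LinearMap.range (lin A)) := by
  rw [rank, span_range_col]

theorem map_ker_le_range_iff (A : Matrix m n ℍ[ℝ])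
    (B : Matrix o l ℍ[ℝ]) (C : Matrix m l ℍ[ℝ]) :
    (LinearMap.ker (lin B)).map (lin C) ≤ LinearMap.range (lin A) ↔
      projR A * C * projL B = 0 := by
  constructor
  · intro h
    apply Matrix.ext_of_mulVec_single
    intro j
    have h1 : lin (projL B) (Pi.single j 1) ∈ LinearMap.ker (lin B) := by
      rw [LinearMap.mem_ker, lin_apply, lin_apply, Matrix.mulVec_mulVec, mul_projL,
        Matrix.zero_mulVec]
    obtain ⟨v, hv⟩ := h (Submodule.mem_map_of_mem h1)
    simp only [lin_apply] at hv
    rw [← Matrix.mulVec_mulVec, ← Matrix.mulVec_mulVec, ← hv, Matrix.mulVec_mulVec, projR_mul,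
      Matrix.zero_mulVec, Matrix.zero_mulVec]
  · rintro h _ ⟨v, hv, rfl⟩
    have hv' : B *ᵥ v = 0 := hv
    have h1 : projL B *ᵥ v = v := by
      rw [projL, Matrix.sub_mulVec, Matrix.one_mulVec, ← Matrix.mulVec_mulVec, hv',
        Matrix.mulVec_zero, sub_zero]
    have h2 : C * projL B = A * (pinv A * (C * projL B)) :=
      (mul_pinv_mul_of_projR (by rw [← Matrix.mul_assoc, h])).symm
    refine ⟨(pinv A * (C * projL B)) *ᵥ v, ?_⟩
    rw [lin_apply, lin_apply, Matrix.mulVec_mulVec, ← h2, ← Matrix.mulVec_mulVec, h1]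

/-- Rank–nullity for the projection of the column space to the lower block: the image is the range
of `B`, and the kernel consists of the vectors `C x + A y` with `B x = 0`. -/
theorem rank_fromBlocks_zero (A : Matrix m n ℍ[ℝ]) (B : Matrix o l ℍ[ℝ]) (C : Matrix m l ℍ[ℝ]) :
    rank (Matrix.fromBlocks C A B 0) = Module.finrank ℍ[ℝ]ᵐᵒᵖ
      ↥((LinearMap.ker (lin B)).map (lin C) ⊔ LinearMap.range (lin A)) + rank B := by
  rw [rank_eq_finrank_range, rank_eq_finrank_range]
  set R := LinearMap.range (lin (Matrix.fromBlocks C A B 0)) with hR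
  -- restriction of a column vector to the lower block
  let π : (m ⊕ o → ℍ[ℝ]) →ₗ[ℍ[ℝ]ᵐᵒᵖ] (o → ℍ[ℝ]) := LinearMap.funLeft ℍ[ℝ]ᵐᵒᵖ ℍ[ℝ] Sum.inr
  let ι : (m ⊕ o → ℍ[ℝ]) →ₗ[ℍ[ℝ]ᵐᵒᵖ] (m → ℍ[ℝ]) := LinearMap.funLeft ℍ[ℝ]ᵐᵒᵖ ℍ[ℝ] Sum.inl
  have hbl : ∀ (x : l → ℍ[ℝ]) (y : n → ℍ[ℝ]), lin (Matrix.fromBlocks C A B 0) (Sum.elim x y)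
      = Sum.elim (C *ᵥ x + A *ᵥ y) (B *ᵥ x) := by
    intro x y
    rw [lin_apply, Matrix.fromBlocks_mulVec]
    simp
  have hmem : ∀ z, z ∈ R ↔ ∃ x y, Sum.elim (C *ᵥ x + A *ᵥ y) (B *ᵥ x) = z := by
    intro z
    constructor
    · rintro ⟨v, rfl⟩
      exact ⟨v ∘ Sum.inl, v ∘ Sum.inr, by rw [← hbl, Sum.elim_comp_inl_inr]⟩
    · rintro ⟨x, y, rfl⟩
      exact ⟨Sum.elim x y, hbl x y⟩
  have h1 := (π.domRestrict R).finrank_range_add_finrank_ker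
  have h2 : LinearMap.range (π.domRestrict R) = LinearMap.range (lin B) := by
    ext z
    simp only [LinearMap.mem_range]
    constructor
    · rintro ⟨⟨u, hu⟩, rfl⟩
      obtain ⟨x, y, rfl⟩ := (hmem u).1 hu
      exact ⟨x, rfl⟩
    · rintro ⟨x, rfl⟩
      exact ⟨⟨_, (hmem _).2 ⟨x, 0, rfl⟩⟩, rfl⟩
  let f : LinearMap.ker (π.domRestrict R) →ₗ[ℍ[ℝ]ᵐᵒᵖ] (m → ℍ[ℝ]) :=
    ι ∘ₗ R.subtype ∘ₗ Submodule.subtype _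
  have hf : Function.Injective f := by
    rintro ⟨⟨u, hu⟩, hu'⟩ ⟨⟨u', h2u⟩, h2u'⟩ h0
    apply Subtype.ext
    apply Subtype.ext
    funext i
    rcases i with i | i
    · exact congrFun h0 i
    · exact congrFun ((LinearMap.mem_ker.1 hu').trans (LinearMap.mem_ker.1 h2u').symm) i
  have h3 : LinearMap.range f
      = (LinearMap.ker (lin B)).map (lin C) ⊔ LinearMap.range (lin A) := by
    ext z
    rw [Submodule.mem_sup]
    constructor
    · rintro ⟨⟨⟨u, hu⟩, hu'⟩, rfl⟩
      obtain ⟨x, y, rfl⟩ := (hmem u).1 hu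
      have hx : x ∈ LinearMap.ker (lin B) := LinearMap.mem_ker.1 hu'
      exact ⟨_, Submodule.mem_map_of_mem hx, _, ⟨y, rfl⟩, rfl⟩
    · rintro ⟨_, ⟨x, hx, rfl⟩, _, ⟨y, rfl⟩, rfl⟩
      have hx' : B *ᵥ x = 0 := hx
      exact ⟨⟨⟨_, (hmem _).2 ⟨x, y, rfl⟩⟩, LinearMap.mem_ker.2 hx'⟩, rfl⟩
  rw [← h1, h2, ← h3, LinearMap.finrank_range_of_inj hf, add_comm]

/-- After cancelling `rank B`, the equality says that `C (ker B) + range A` has the same dimension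
as its subspace `range A`, hence equals it. -/
theorem rank_fromBlocks_zero_eq_add_iff (A : Matrix m n ℍ[ℝ])
    (B : Matrix o l ℍ[ℝ]) (C : Matrix m l ℍ[ℝ]) :
    rank (Matrix.fromBlocks C A B 0) = rank A + rank B ↔ projR A * C * projL B = 0 := by
  rw [rank_fromBlocks_zero, Nat.add_right_cancel_iff, ← map_ker_le_range_iff,
    rank_eq_finrank_range A]
  constructor
  · intro h
    have := Submodule.eq_of_le_of_finrank_eq (le_sup_right : LinearMap.range (lin A) ≤
      (LinearMap.ker (lin B)).map (lin C) ⊔ LinearMap.range (lin A)) h.symm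
    rw [this]
    exact le_sup_left
  · intro h
    rw [sup_eq_right.2 h]

end Rank

end QMatrix

namespace QMatrix

/-! ### Correcting a matrix on a kernel while keeping it on a range. -/

section Extension

variable {a b b' v v' v'' w : Type*} [Fintype a] [Fintype b] [Fintype b'] [Fintype v]
  [Fintype v'] [Fintype v''] [Fintype w] [DecidableEq a] [DecidableEq b] [DecidableEq b']
  [DecidableEq v] [DecidableEq v'] [DecidableEq v''] [DecidableEq w]

/-- A matrix `X` can be changed, without changing it on the range of `Q`, so that `T X = D` on the
kernel of `B`, provided that `D` maps this kernel into the range of `T` and that `T X = D` holds on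
the intersection of the kernel with the range of `Q`. -/
theorem exists_extend (Q : Matrix w a ℍ[ℝ]) (B : Matrix b w ℍ[ℝ]) (T : Matrix v' v ℍ[ℝ])
    (D : Matrix v' w ℍ[ℝ]) (X : Matrix v w ℍ[ℝ]) (hD : projR T * D * projL B = 0)
    (hX : (D - T * X) * Q * projL (B * Q) = 0) :
    ∃ X' : Matrix v w ℍ[ℝ], X' * Q = X * Q ∧ T * X' * projL B = D * projL B := by
  -- `p` kills the range of `Q`, and `p f - f` lies in the intersection for `f` in the kernel
  set p : Matrix w w ℍ[ℝ] := projL B * pinv (projR Q * projL B) * projR Q with hp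
  have hpQ : p * Q = 0 := by rw [hp, Matrix.mul_assoc, projR_mul, Matrix.mul_zero]
  have hBp : B * p = 0 := by
    rw [hp, ← Matrix.mul_assoc, ← Matrix.mul_assoc, mul_projL, Matrix.zero_mul, Matrix.zero_mul]
  set Y : Matrix w w ℍ[ℝ] := p * projL B - projL B with hY
  have hRY : projR Q * Y = 0 := by
    have := (pinv_spec (projR Q * projL B)).mul_mul_self
    rw [hY, hp, Matrix.mul_sub, sub_eq_zero]
    simpa only [Matrix.mul_assoc] using this
  have hBY : B * Y = 0 := by
    rw [hY, Matrix.mul_sub, ← Matrix.mul_assoc, hBp, mul_projL, Matrix.zero_mul, sub_zero]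
  have hQY : Q * (pinv Q * Y) = Y := mul_pinv_mul_of_projR hRY
  -- The columns of `Y` lie in both `ker B` and the range of `Q`, where the equation is assumed.
  -- Hence `(D - T X) p` and `D - T X` agree on `ker B`, and adding `T† (D - T X) p` to `X` repairs
  -- it there.
  have hzero : (D - T * X) * Y = 0 := by
    have h1 : B * Q * (pinv Q * Y) = 0 := by rw [Matrix.mul_assoc, hQY, hBY]
    rw [← hQY, ← projL_mul_of_mul_eq_zero h1, ← Matrix.mul_assoc, ← Matrix.mul_assoc, hX,
      Matrix.zero_mul]
  have hTT : T * (pinv T * ((D - T * X) * p)) = (D - T * X) * p := by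
    apply mul_pinv_mul_of_projR
    have h1 : projR T * (D - T * X) * projL B = 0 := by
      rw [Matrix.mul_sub, ← Matrix.mul_assoc _ T, projR_mul, Matrix.zero_mul, sub_zero, hD]
    rw [hp, ← Matrix.mul_assoc, ← Matrix.mul_assoc, ← Matrix.mul_assoc, h1, Matrix.zero_mul,
      Matrix.zero_mul]
  refine ⟨X + pinv T * (D - T * X) * p, ?_, ?_⟩
  · rw [Matrix.add_mul, Matrix.mul_assoc _ p, hpQ, Matrix.mul_zero, add_zero]
  · rw [Matrix.mul_add, Matrix.mul_assoc (pinv T), hTT, Matrix.add_mul, Matrix.mul_assoc _ p]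
    rw [hY, Matrix.mul_sub, sub_eq_zero] at hzero
    rw [hzero, Matrix.sub_mul]
    abel

/-- `exists_extend` for a kernel containing a kernel on which `X` is already prescribed. -/
theorem exists_extend_flag (Q : Matrix w a ℍ[ℝ]) (B : Matrix b w ℍ[ℝ]) (B' : Matrix b' b ℍ[ℝ])
    (T : Matrix v' v ℍ[ℝ]) (T' : Matrix v'' v' ℍ[ℝ]) (D : Matrix v' w ℍ[ℝ])
    (D' : Matrix v'' w ℍ[ℝ]) (X : Matrix v w ℍ[ℝ]) (hXB : T * X * projL B = D * projL B)
    (hDD : D' * projL B = T' * D * projL B) (hD : projR (T' * T) * D' * projL (B' * B) = 0)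
    (hX : (D' - T' * T * X) * Q * projL (B' * B * Q) = 0) :
    ∃ X' : Matrix v w ℍ[ℝ], X' * Q = X * Q ∧ X' * projL B = X * projL B ∧
      T' * T * X' * projL (B' * B) = D' * projL (B' * B) := by
  have hBY : B' * B * Matrix.fromCols Q (projL B)
      * projL (B' * B * Matrix.fromCols Q (projL B)) = 0 := mul_projL _
  set Y := projL (B' * B * Matrix.fromCols Q (projL B)) with hYdef
  have hY : Y = Matrix.fromRows Y.toRows₁ Y.toRows₂ := (Matrix.fromRows_toRows Y).symm
  have h1 : B' * B * Q * Y.toRows₁ = 0 := by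
    rw [hY, Matrix.mul_fromCols, Matrix.fromCols_mul_fromRows, Matrix.mul_assoc B' B (projL B),
      mul_projL, Matrix.mul_zero, Matrix.zero_mul, add_zero] at hBY
    exact hBY
  have h2 : (D' - T' * T * X) * projL B = 0 := by
    rw [Matrix.sub_mul, hDD, Matrix.mul_assoc, ← hXB]
    simp only [Matrix.mul_assoc, sub_self]
  -- Enlarging `Q` by the columns of `L_B` freezes `X` on `ker B` too. The enlargement adds no new
  -- condition, because `D' - T' T X` already vanishes on `ker B`.
  obtain ⟨X', hQ', hT'⟩ := exists_extend (Matrix.fromCols Q (projL B)) (B' * B) (T' * T) D' X hD (by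
    rw [← hYdef, hY, Matrix.mul_fromCols, Matrix.fromCols_mul_fromRows, h2, Matrix.zero_mul,
      add_zero, ← projL_mul_of_mul_eq_zero h1, ← Matrix.mul_assoc, hX, Matrix.zero_mul])
  rw [Matrix.mul_fromCols, Matrix.mul_fromCols, Matrix.fromCols_inj.eq_iff] at hQ'
  exact ⟨X', hQ'.1, hQ'.2, hT'⟩

theorem projL_mul_projL_of_mul (B' : Matrix b' b ℍ[ℝ]) (B : Matrix b w ℍ[ℝ]) :
    projL (B' * B) * projL B = projL B :=
  projL_mul_of_mul_eq_zero (by rw [Matrix.mul_assoc, mul_projL, Matrix.mul_zero])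

end Extension

/-! ### Prescribing a matrix along a flag of kernels. -/

section Flags

variable {a b₁ b₂ b₃ b₄ v v₁ v₂ v₃ v₄ w : Type*} [Fintype a] [Fintype b₁] [Fintype b₂]
  [Fintype b₃] [Fintype b₄] [Fintype v] [Fintype v₁] [Fintype v₂] [Fintype v₃] [Fintype v₄]
  [Fintype w] [DecidableEq a] [DecidableEq b₁] [DecidableEq b₂] [DecidableEq b₃] [DecidableEq b₄]
  [DecidableEq v] [DecidableEq v₁] [DecidableEq v₂] [DecidableEq v₃] [DecidableEq v₄]
  [DecidableEq w]

variable (Q : Matrix w a ℍ[ℝ]) (X : Matrix v w ℍ[ℝ])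
  (B₁ : Matrix b₁ w ℍ[ℝ]) (B₂ : Matrix b₂ b₁ ℍ[ℝ]) (B₃ : Matrix b₃ b₂ ℍ[ℝ])
  (B₄ : Matrix b₄ b₃ ℍ[ℝ])
  (A₁ : Matrix v₁ v ℍ[ℝ]) (A₂ : Matrix v₂ v₁ ℍ[ℝ]) (A₃ : Matrix v₃ v₂ ℍ[ℝ])
  (A₄ : Matrix v₄ v₃ ℍ[ℝ])
  {D₁ : Matrix v₁ w ℍ[ℝ]} {D₂ : Matrix v₂ w ℍ[ℝ]} {D₃ : Matrix v₃ w ℍ[ℝ]} {D₄ : Matrix v₄ w ℍ[ℝ]}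

/-- Iteration of `exists_extend_flag`: two nested kernels. -/
theorem exists_extend_two
    (h₁ : projR A₁ * D₁ * projL B₁ = 0)
    (h₂ : projR (A₂ * A₁) * D₂ * projL (B₂ * B₁) = 0)
    (d₂ : D₂ * projL B₁ = A₂ * D₁ * projL B₁)
    (x₁ : (D₁ - A₁ * X) * Q * projL (B₁ * Q) = 0)
    (x₂ : (D₂ - A₂ * A₁ * X) * Q * projL (B₂ * B₁ * Q) = 0) :
    ∃ X' : Matrix v w ℍ[ℝ], X' * Q = X * Q ∧ A₁ * X' * projL B₁ = D₁ * projL B₁ ∧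
      A₂ * A₁ * X' * projL (B₂ * B₁) = D₂ * projL (B₂ * B₁) := by
  obtain ⟨Y, hQ, hY⟩ := exists_extend Q B₁ A₁ D₁ X h₁ x₁
  obtain ⟨Z, hQ', hZ, hZ'⟩ := exists_extend_flag Q B₁ B₂ A₁ A₂ D₁ D₂ Y hY d₂ h₂
    (by rw [Matrix.sub_mul, Matrix.mul_assoc _ Y, hQ, ← Matrix.mul_assoc, ← Matrix.sub_mul, x₂])
  exact ⟨Z, hQ'.trans hQ, by rw [Matrix.mul_assoc, hZ, ← Matrix.mul_assoc, hY], hZ'⟩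

/-- Iteration of `exists_extend_flag`: three nested kernels. -/
theorem exists_extend_three
    (h₁ : projR A₁ * D₁ * projL B₁ = 0)
    (h₂ : projR (A₂ * A₁) * D₂ * projL (B₂ * B₁) = 0)
    (h₃ : projR (A₃ * (A₂ * A₁)) * D₃ * projL (B₃ * (B₂ * B₁)) = 0)
    (d₂ : D₂ * projL B₁ = A₂ * D₁ * projL B₁)
    (d₃ : D₃ * projL (B₂ * B₁) = A₃ * D₂ * projL (B₂ * B₁))
    (x₁ : (D₁ - A₁ * X) * Q * projL (B₁ * Q) = 0)
    (x₂ : (D₂ - A₂ * A₁ * X) * Q * projL (B₂ * B₁ * Q) = 0)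
    (x₃ : (D₃ - A₃ * (A₂ * A₁) * X) * Q * projL (B₃ * (B₂ * B₁) * Q) = 0) :
    ∃ X' : Matrix v w ℍ[ℝ], X' * Q = X * Q ∧ A₁ * X' * projL B₁ = D₁ * projL B₁ ∧
      A₂ * A₁ * X' * projL (B₂ * B₁) = D₂ * projL (B₂ * B₁) ∧
      A₃ * (A₂ * A₁) * X' * projL (B₃ * (B₂ * B₁)) = D₃ * projL (B₃ * (B₂ * B₁)) := by
  obtain ⟨Y, hQ, hY₁, hY₂⟩ := exists_extend_two Q X B₁ B₂ A₁ A₂ h₁ h₂ d₂ x₁ x₂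
  obtain ⟨Z, hQ', hZ, hZ'⟩ := exists_extend_flag Q (B₂ * B₁) B₃ (A₂ * A₁) A₃ D₂ D₃ Y hY₂ d₃ h₃
    (by rw [Matrix.sub_mul, Matrix.mul_assoc _ Y, hQ, ← Matrix.mul_assoc, ← Matrix.sub_mul, x₃])
  have hZ₁ : Z * projL B₁ = Y * projL B₁ := by
    rw [← projL_mul_projL_of_mul B₂ B₁, ← Matrix.mul_assoc, hZ, Matrix.mul_assoc]
  exact ⟨Z, hQ'.trans hQ, by rw [Matrix.mul_assoc, hZ₁, ← Matrix.mul_assoc, hY₁],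
    by rw [Matrix.mul_assoc, hZ, ← Matrix.mul_assoc, hY₂], hZ'⟩

/-- Iteration of `exists_extend_flag`: four nested kernels, nothing else prescribed. -/
theorem exists_extend_four
    (h₁ : projR A₁ * D₁ * projL B₁ = 0)
    (h₂ : projR (A₂ * A₁) * D₂ * projL (B₂ * B₁) = 0)
    (h₃ : projR (A₃ * (A₂ * A₁)) * D₃ * projL (B₃ * (B₂ * B₁)) = 0)
    (h₄ : projR (A₄ * (A₃ * (A₂ * A₁))) * D₄ * projL (B₄ * (B₃ * (B₂ * B₁))) = 0)
    (d₂ : D₂ * projL B₁ = A₂ * D₁ * projL B₁)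
    (d₃ : D₃ * projL (B₂ * B₁) = A₃ * D₂ * projL (B₂ * B₁))
    (d₄ : D₄ * projL (B₃ * (B₂ * B₁)) = A₄ * D₃ * projL (B₃ * (B₂ * B₁))) :
    ∃ X : Matrix v w ℍ[ℝ], A₁ * X * projL B₁ = D₁ * projL B₁ ∧
      A₂ * A₁ * X * projL (B₂ * B₁) = D₂ * projL (B₂ * B₁) ∧
      A₃ * (A₂ * A₁) * X * projL (B₃ * (B₂ * B₁)) = D₃ * projL (B₃ * (B₂ * B₁)) ∧
      A₄ * (A₃ * (A₂ * A₁)) * X * projL (B₄ * (B₃ * (B₂ * B₁)))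
        = D₄ * projL (B₄ * (B₃ * (B₂ * B₁))) := by
  -- A matrix `Q` with no columns makes the prescription on its range vacuous.
  obtain ⟨Y, -, hY₁, hY₂, hY₃⟩ := exists_extend_three (0 : Matrix w (Fin 0) ℍ[ℝ])
    (0 : Matrix v w ℍ[ℝ]) B₁ B₂ B₃ A₁ A₂ A₃ h₁ h₂ h₃ d₂ d₃ (by simp) (by simp) (by simp)
  obtain ⟨Z, -, hZ, hZ'⟩ := exists_extend_flag (0 : Matrix w (Fin 0) ℍ[ℝ]) (B₃ * (B₂ * B₁)) B₄
    (A₃ * (A₂ * A₁)) A₄ D₃ D₄ Y hY₃ d₄ h₄ (by simp)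
  have hZ₂ : Z * projL (B₂ * B₁) = Y * projL (B₂ * B₁) := by
    rw [← projL_mul_projL_of_mul B₃ (B₂ * B₁), ← Matrix.mul_assoc, hZ, Matrix.mul_assoc]
  have hZ₁ : Z * projL B₁ = Y * projL B₁ := by
    rw [← projL_mul_projL_of_mul B₂ B₁, ← Matrix.mul_assoc, hZ₂, Matrix.mul_assoc]
  exact ⟨Z, by rw [Matrix.mul_assoc, hZ₁, ← Matrix.mul_assoc, hY₁],
    by rw [Matrix.mul_assoc, hZ₂, ← Matrix.mul_assoc, hY₂],
    by rw [Matrix.mul_assoc, hZ, ← Matrix.mul_assoc, hY₃], hZ'⟩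

end Flags
end QMatrix

/-! ### Consistency and the rank conditions. -/

namespace ChainSystem

open QMatrix

variable {n₁ n₂ n₃ n₄ n₅ q₁ q₂ q₃ q₄ q₅ : ℕ}
  (σ : ChainSystem n₁ n₂ n₃ n₄ n₅ q₁ q₂ q₃ q₄ q₅)

/-- Multiplying each equation of a string by the later `A`s on the left and the earlier `B`s on the
right and adding, the inner unknowns cancel and only the first and last remain. -/
theorem rankConditions_of_consistent (h : σ.Consistent) : σ.RankConditions := by
  obtain ⟨X₁, X₂, X₃, X₄, X₅, h₁, h₂, h₃, h₄⟩ := h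
  simp only [RankConditions, rank_fromBlocks_zero_eq_add_iff]
  refine ⟨⟨projR_mul_mul_projL_of_sub h₁, projR_mul_mul_projL_of_sub h₂,
    projR_mul_mul_projL_of_sub h₃, projR_mul_mul_projL_of_sub h₄⟩,
    ⟨projR_mul_mul_projL_of_sub (X := X₁) (Y := X₃) ?_,
    projR_mul_mul_projL_of_sub (X := X₂) (Y := X₄) ?_,
    projR_mul_mul_projL_of_sub (X := X₃) (Y := X₅) ?_⟩,
    ⟨projR_mul_mul_projL_of_sub (X := X₁) (Y := X₄) ?_,
    projR_mul_mul_projL_of_sub (X := X₂) (Y := X₅) ?_⟩,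
    projR_mul_mul_projL_of_sub (X := X₁) (Y := X₅) ?_⟩
  all_goals
    simp only [← h₁, ← h₂, ← h₃, ← h₄, Matrix.mul_sub, Matrix.sub_mul, Matrix.mul_assoc]
    abel

/-- If `X` solves the telescoped equations starting at an earlier index on the corresponding
kernels, then every `Y` with `Y B = A X - C` solves them starting at the next index, on the
intersections of the kernels with the range of `B`. -/
theorem telescope_step {v w v' w' v'' w'' : ℕ} {A : HMat v' v} {B : HMat w' w} {C : HMat v' w}
    {T : HMat v'' v'} {S : HMat w'' w'} {D : HMat v'' w'} {X : HMat v w} {Y : HMat v' w'}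
    (hY : Y * B = A * X - C)
    (hX : T * A * X * projL (S * B) = (T * C + D * B) * projL (S * B)) :
    (D - T * Y) * B * projL (S * B) = 0 := by
  have h1 : (D - T * Y) * B = T * C + D * B - T * A * X := by
    rw [Matrix.sub_mul, Matrix.mul_assoc T Y, hY, Matrix.mul_sub]
    simp only [Matrix.mul_assoc]
    abel
  rw [h1, Matrix.sub_mul, hX, sub_self]

theorem exists_mul_eq {v w v' w' : ℕ} {A : HMat v' v} {B : HMat w' w} {C : HMat v' w}
    {X : HMat v w} (hX : A * X * projL B = C * projL B) :
    ∃ Y : HMat v' w', Y * B = A * X - C :=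
  ⟨(A * X - C) * pinv B, mul_pinv_mul_of_projL (by rw [Matrix.sub_mul, hX, sub_self])⟩

theorem consistent_of_rankConditions (h : σ.RankConditions) : σ.Consistent := by
  simp only [RankConditions, rank_fromBlocks_zero_eq_add_iff] at h
  obtain ⟨⟨h₁, h₂, h₃, h₄⟩, ⟨h₁₂, h₂₃, h₃₄⟩, ⟨h₁₃, h₂₄⟩, h₁₄⟩ := h
  obtain ⟨A₁, A₂, A₃, A₄, B₁, B₂, B₃, B₄, C₁, C₂, C₃, C₄⟩ := σ
  dsimp only at *
  -- Written in nested form, each telescoped right side is `A D + C B` with `D` the previous one and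
  -- `B` the preceding product, so on `ker B` it reduces to `A D`. This is the compatibility along
  -- the flag.
  have dcompat : ∀ {v v' w' x : ℕ} (A : HMat v' v) (D : HMat v x) (C : HMat v' w')
      (B : HMat w' x),
      (A * D + C * B) * projL B = A * D * projL B := by
    intro v v' w' x A D C B
    rw [Matrix.add_mul, Matrix.mul_assoc C, mul_projL, Matrix.mul_zero, add_zero]
  have e₁₃ : A₃ * A₂ * C₁ + A₃ * C₂ * B₁ + C₃ * B₂ * B₁
      = A₃ * (A₂ * C₁ + C₂ * B₁) + C₃ * (B₂ * B₁) := by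
    simp only [Matrix.mul_add, Matrix.mul_assoc]
  have e₂₄ : A₄ * A₃ * C₂ + A₄ * C₃ * B₂ + C₄ * B₃ * B₂
      = A₄ * (A₃ * C₂ + C₃ * B₂) + C₄ * (B₃ * B₂) := by
    simp only [Matrix.mul_add, Matrix.mul_assoc]
  have e₁₄ : A₄ * A₃ * A₂ * C₁ + A₄ * A₃ * C₂ * B₁ + A₄ * C₃ * B₂ * B₁ + C₄ * B₃ * B₂ * B₁
      = A₄ * (A₃ * (A₂ * C₁ + C₂ * B₁) + C₃ * (B₂ * B₁)) + C₄ * (B₃ * (B₂ * B₁)) := by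
    simp only [Matrix.mul_add, Matrix.mul_assoc]
  rw [e₁₃, Matrix.mul_assoc A₃, Matrix.mul_assoc B₃] at h₁₃
  rw [e₂₄, Matrix.mul_assoc A₄, Matrix.mul_assoc B₄] at h₂₄
  rw [e₁₄, Matrix.mul_assoc A₄, Matrix.mul_assoc A₄, Matrix.mul_assoc A₃, Matrix.mul_assoc B₄,
    Matrix.mul_assoc B₄, Matrix.mul_assoc B₃] at h₁₄
  obtain ⟨X₁, x₁, x₁₂, x₁₃, x₁₄⟩ := exists_extend_four B₁ B₂ B₃ B₄ A₁ A₂ A₃ A₄ h₁ h₁₂ h₁₃ h₁₄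
    (dcompat _ _ _ _) (dcompat _ _ _ _) (dcompat _ _ _ _)
  -- `Y₂` solves the first equation but is only right on the range of `B₁`. `X₂` keeps these values
  -- and is corrected elsewhere to meet the later equations; the same two moves give `X₃` and `X₄`,
  -- with one condition fewer each time.
  obtain ⟨Y₂, hY₂⟩ := exists_mul_eq x₁
  obtain ⟨X₂, hX₂, x₂, x₂₃, x₂₄⟩ := exists_extend_three B₁ Y₂ B₂ B₃ B₄ A₂ A₃ A₄ h₂ h₂₃ h₂₄
    (dcompat _ _ _ _) (dcompat _ _ _ _) (telescope_step hY₂ x₁₂)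
    (telescope_step hY₂ (by
      simpa only [Matrix.mul_add, Matrix.add_mul, Matrix.mul_assoc, add_assoc] using x₁₃))
    (telescope_step hY₂ (by
      simpa only [Matrix.mul_add, Matrix.add_mul, Matrix.mul_assoc, add_assoc] using x₁₄))
  obtain ⟨Y₃, hY₃⟩ := exists_mul_eq x₂
  obtain ⟨X₃, hX₃, x₃, x₃₄⟩ := exists_extend_two B₂ Y₃ B₃ B₄ A₃ A₄ h₃ h₃₄
    (dcompat _ _ _ _) (telescope_step hY₃ x₂₃)
    (telescope_step hY₃ (by
      simpa only [Matrix.mul_add, Matrix.add_mul, Matrix.mul_assoc, add_assoc] using x₂₄))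
  obtain ⟨Y₄, hY₄⟩ := exists_mul_eq x₃
  obtain ⟨X₄, hX₄, x₄⟩ := exists_extend B₃ B₄ A₄ C₄ Y₄ h₄ (telescope_step hY₄ x₃₄)
  obtain ⟨X₅, hX₅⟩ := exists_mul_eq x₄
  refine ⟨X₁, X₂, X₃, X₄, X₅, ?_, ?_, ?_, ?_⟩
  · rw [hX₂, hY₂, sub_sub_cancel]
  · rw [hX₃, hY₃, sub_sub_cancel]
  · rw [hX₄, hY₄, sub_sub_cancel]
  · rw [hX₅, sub_sub_cancel]

end ChainSystem

namespace QMatrix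

/-! ### Half of the chain: two consecutive equations. -/

section TwoStepChain

variable {n₁ n₂ n₃ q₁ q₂ q₃ : ℕ} {A₁ : HMat n₂ n₁} {A₂ : HMat n₃ n₂} {B₁ : HMat q₂ q₁}
  {B₂ : HMat q₃ q₂} {C₁ : HMat n₂ q₁} {C₂ : HMat n₃ q₂}

theorem chain_second_eq_iff (U : HMat n₁ q₂) (V : HMat n₂ q₂) (X₃ : HMat n₃ q₃) :
    A₂ * (-(projR A₁ * C₁ * pinv B₁) + A₁ * U + V * projR B₁) - X₃ * B₂ = C₂ ↔
      A₂ * A₁ * U - X₃ * B₂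
        = C₂ + A₂ * projR A₁ * C₁ * pinv B₁ - A₂ * V * projR B₁ := by
  rw [← sub_eq_zero, ← sub_eq_zero (a := A₂ * A₁ * U - X₃ * B₂)]
  simp only [Matrix.mul_add, Matrix.mul_neg, Matrix.mul_assoc]
  constructor <;> intro h <;> rw [← h] <;> abel

theorem chain_residual_eq (V : HMat n₂ q₂) :
    projR (A₂ * A₁) * (C₂ + A₂ * projR A₁ * C₁ * pinv B₁ - A₂ * V * projR B₁) * projL B₂
      = projR (A₂ * A₁) * (A₂ * projR A₁ * C₁ * pinv B₁ + C₂) * projL B₂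
        - projR (A₂ * A₁) * A₂ * V * (projR B₁ * projL B₂) := by
  simp only [Matrix.mul_add, Matrix.mul_sub, Matrix.add_mul, Matrix.sub_mul, Matrix.mul_assoc]
  abel

/-- After inserting the general `X₂`, the second equation is solvable for `U` and `X₃` only under a
restriction on `V`; this turns that restriction into `A₁₁ V B₁₁ = C₁₁`. -/
theorem chain_residual_eq_zero_iff (V : HMat n₂ q₂) :
    projR (A₂ * A₁) * (C₂ + A₂ * projR A₁ * C₁ * pinv B₁ - A₂ * V * projR B₁) * projL B₂ = 0 ↔
      projR (A₂ * A₁) * A₂ * V * (projR B₁ * projL B₂)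
        = projR (A₂ * A₁) * (A₂ * projR A₁ * C₁ * pinv B₁ + C₂) * projL B₂ := by
  rw [chain_residual_eq, sub_eq_zero, eq_comm]

/-- Necessary conditions for `A₁ X₁ - X₂ B₁ = C₁`, `A₂ X₂ - X₃ B₂ = C₂`. -/
theorem two_step_necessary {A₁₁ : HMat n₃ n₂} {B₁₁ : HMat q₂ q₂} {C₁₁ : HMat n₃ q₂}
    (hA : A₁₁ = projR (A₂ * A₁) * A₂) (hB : B₁₁ = projR B₁ * projL B₂)
    (hC : C₁₁ = projR (A₂ * A₁) * (A₂ * projR A₁ * C₁ * pinv B₁ + C₂) * projL B₂)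
    {X₁ : HMat n₁ q₁} {X₂ : HMat n₂ q₂} {X₃ : HMat n₃ q₃}
    (h : A₁ * X₁ - X₂ * B₁ = C₁ ∧ A₂ * X₂ - X₃ * B₂ = C₂) :
    projR A₁ * C₁ * projL B₁ = 0 ∧ projR A₁₁ * C₁₁ = 0 ∧ C₁₁ * projL B₁₁ = 0 := by
  obtain ⟨h₁, h₂⟩ := h
  have hc := projR_mul_mul_projL_of_sub h₁
  obtain ⟨U, V, W, rfl, rfl⟩ := (mul_sub_mul_eq_iff hc _ _).1 h₁
  rw [chain_second_eq_iff] at h₂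
  have h₃ := (chain_residual_eq_zero_iff V).1 (projR_mul_mul_projL_of_sub h₂)
  rw [← hA, ← hB, ← hC] at h₃
  exact ⟨hc, projR_mul_of_mul_mul h₃, mul_projL_of_mul_mul h₃⟩

/-- The general solution of `A₁ X₁ - X₂ B₁ = C₁`, `A₂ X₂ - X₃ B₂ = C₂`. -/
theorem two_step_eq_iff {A₁₁ : HMat n₃ n₂} {B₁₁ : HMat q₂ q₂} {C₁₁ : HMat n₃ q₂}
    (hA : A₁₁ = projR (A₂ * A₁) * A₂) (hB : B₁₁ = projR B₁ * projL B₂)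
    (hC : C₁₁ = projR (A₂ * A₁) * (A₂ * projR A₁ * C₁ * pinv B₁ + C₂) * projL B₂)
    (h₁ : projR A₁ * C₁ * projL B₁ = 0) (h₂ : projR A₁₁ * C₁₁ = 0) (h₃ : C₁₁ * projL B₁₁ = 0)
    (X₁ : HMat n₁ q₁) (X₂ : HMat n₂ q₂) (X₃ : HMat n₃ q₃) :
    (A₁ * X₁ - X₂ * B₁ = C₁ ∧ A₂ * X₂ - X₃ * B₂ = C₂) ↔
      ∃ (W₁ : HMat n₁ q₁) (W₂ W₃ : HMat n₂ q₂) (W₄ : HMat n₁ q₃) (W₅ : HMat n₃ q₃)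
        (W₆ : HMat n₁ q₂) (V : HMat n₂ q₂) (U : HMat n₁ q₂),
        V = pinv A₁₁ * C₁₁ * pinv B₁₁ + projL A₁₁ * W₂ + W₃ * projR B₁₁ ∧
        U = pinv (A₂ * A₁) * (C₂ + A₂ * projR A₁ * C₁ * pinv B₁ - A₂ * V * projR B₁)
          + W₄ * B₂ + projL (A₂ * A₁) * W₆ ∧
        X₁ = pinv A₁ * C₁ + U * B₁ + projL A₁ * W₁ ∧
        X₂ = -(projR A₁ * C₁ * pinv B₁) + A₁ * U + V * projR B₁ ∧
        X₃ = -(projR (A₂ * A₁) * (C₂ + A₂ * projR A₁ * C₁ * pinv B₁ - A₂ * V * projR B₁)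
            * pinv B₂) + A₂ * A₁ * W₄ + W₅ * projR B₂ := by
  constructor
  · rintro ⟨e₁, e₂⟩
    obtain ⟨U, V, W, rfl, rfl⟩ := (mul_sub_mul_eq_iff h₁ _ _).1 e₁
    rw [chain_second_eq_iff] at e₂
    have hz := projR_mul_mul_projL_of_sub e₂
    have hV := (chain_residual_eq_zero_iff V).1 hz
    rw [← hA, ← hB, ← hC] at hV
    obtain ⟨W₂, W₃, hV'⟩ := (mul_mul_eq_iff h₂ h₃ V).1 hV
    obtain ⟨W₄, W₅, W₆, hU, hX⟩ := (mul_sub_mul_eq_iff hz _ _).1 e₂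
    exact ⟨W, W₂, W₃, W₄, W₅, W₆, V, U, hV', hU, rfl, rfl, hX⟩
  · rintro ⟨W₁, W₂, W₃, W₄, W₅, W₆, V, U, hV, hU, hX₁, hX₂, hX₃⟩
    refine ⟨(mul_sub_mul_eq_iff h₁ _ _).2 ⟨U, V, W₁, hX₁, hX₂⟩, ?_⟩
    have hV' := (mul_mul_eq_iff h₂ h₃ V).2 ⟨W₂, W₃, hV⟩
    rw [hA, hB, hC] at hV'
    rw [hX₂, chain_second_eq_iff]
    exact (mul_sub_mul_eq_iff ((chain_residual_eq_zero_iff V).2 hV') _ _).2 ⟨W₄, W₅, W₆, hU, hX₃⟩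

/-- The last unknown of the two-step chain, with the dependence on `W₂` eliminated. -/
theorem chain_last_eq {A₁₁ : HMat n₃ n₂} {B₁₁ : HMat q₂ q₂} {C₁₁ : HMat n₃ q₂}
    (hA : A₁₁ = projR (A₂ * A₁) * A₂) (h₂ : projR A₁₁ * C₁₁ = 0)
    {W₂ W₃ V : HMat n₂ q₂} (W₄ : HMat n₁ q₃) (W₅ : HMat n₃ q₃)
    (hV : V = pinv A₁₁ * C₁₁ * pinv B₁₁ + projL A₁₁ * W₂ + W₃ * projR B₁₁) :
    -(projR (A₂ * A₁) * (C₂ + A₂ * projR A₁ * C₁ * pinv B₁ - A₂ * V * projR B₁) * pinv B₂)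
        + A₂ * A₁ * W₄ + W₅ * projR B₂
      = -(projR (A₂ * A₁) * C₂ * pinv B₂) - A₁₁ * projR A₁ * C₁ * pinv B₁ * pinv B₂
        + C₁₁ * pinv B₁₁ * projR B₁ * pinv B₂
        + A₁₁ * W₃ * (projR B₁₁ * projR B₁ * pinv B₂) + A₂ * A₁ * W₄ + W₅ * projR B₂ := by
  -- `V` enters the last unknown only through `A₁₁ V`, and `A₁₁ L_{A₁₁} = 0` removes `W₂`.
  have hAV : A₁₁ * V = C₁₁ * pinv B₁₁ + A₁₁ * W₃ * projR B₁₁ := by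
    rw [hV, Matrix.mul_add, Matrix.mul_add, ← Matrix.mul_assoc A₁₁ (projL A₁₁), mul_projL,
      Matrix.zero_mul, add_zero, Matrix.mul_assoc (pinv A₁₁), ← Matrix.mul_assoc A₁₁ W₃,
      mul_pinv_mul_of_projR (by rw [← Matrix.mul_assoc, h₂, Matrix.zero_mul])]
  have hexp : projR (A₂ * A₁) * (C₂ + A₂ * projR A₁ * C₁ * pinv B₁ - A₂ * V * projR B₁) * pinv B₂
      = projR (A₂ * A₁) * C₂ * pinv B₂ + A₁₁ * projR A₁ * C₁ * pinv B₁ * pinv B₂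
        - A₁₁ * V * projR B₁ * pinv B₂ := by
    rw [hA]
    simp only [Matrix.mul_add, Matrix.mul_sub, Matrix.add_mul, Matrix.sub_mul, Matrix.mul_assoc]
  rw [hexp, hAV]
  simp only [Matrix.add_mul, Matrix.mul_assoc]
  abel

/-- The first unknown of the two-step chain, with the dependence on `V` eliminated. -/
theorem chain_first_eq (h₁ : projR A₁ * C₁ * projL B₁ = 0) {V : HMat n₂ q₂} {U : HMat n₁ q₂}
    (W₁ : HMat n₁ q₁) (W₄ : HMat n₁ q₃) (W₆ : HMat n₁ q₂)
    (hU : U = pinv (A₂ * A₁) * (C₂ + A₂ * projR A₁ * C₁ * pinv B₁ - A₂ * V * projR B₁)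
          + W₄ * B₂ + projL (A₂ * A₁) * W₆) :
    pinv A₁ * C₁ + U * B₁ + projL A₁ * W₁
      = pinv A₁ * C₁ + pinv (A₂ * A₁) * C₂ * B₁ + pinv (A₂ * A₁) * A₂ * projR A₁ * C₁
        + projL A₁ * W₁ + W₄ * B₂ * B₁ + projL (A₂ * A₁) * W₆ * B₁ := by
  have e₁ : projR A₁ * (C₁ * (pinv B₁ * B₁)) = projR A₁ * C₁ := by
    have := mul_pinv_mul_of_projL h₁
    simpa only [Matrix.mul_assoc] using this
  -- In `U B₁` the term with `V` disappears because `R_{B₁} B₁ = 0`.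
  rw [hU]
  simp only [Matrix.mul_add, Matrix.mul_sub, Matrix.add_mul, Matrix.sub_mul, Matrix.mul_assoc, e₁,
    projR_mul, Matrix.mul_zero, sub_zero]
  abel

end TwoStepChain

end QMatrix

/-! ### Gluing the two halves at the middle unknown. -/

namespace ChainSystem

open QMatrix

variable {n₁ n₂ n₃ n₄ n₅ q₁ q₂ q₃ q₄ q₅ : ℕ}
  (σ : ChainSystem n₁ n₂ n₃ n₄ n₅ q₁ q₂ q₃ q₄ q₅)

/-- Equality of the two expressions for `X₃` obtained from the two halves of the chain. -/
theorem middle_eq_iff (W₃ : HMat n₂ q₂) (T₆ : HMat n₃ q₄)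
    (P : Matrix (Fin n₁ ⊕ Fin n₃) (Fin q₃) ℍ[ℝ]) (Q : Matrix (Fin n₃) (Fin q₃ ⊕ Fin q₅) ℍ[ℝ]) :
    (-(projR (σ.A₂ * σ.A₁) * σ.C₂ * pinv σ.B₂)
      - σ.A₁₁ * projR σ.A₁ * σ.C₁ * pinv σ.B₁ * pinv σ.B₂
      + σ.C₁₁ * pinv σ.B₁₁ * projR σ.B₁ * pinv σ.B₂
      + σ.A₁₁ * W₃ * σ.A₄₄ + σ.A₂ * σ.A₁ * P.toRows₁ + Q.toCols₁ * projR σ.B₂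
      = pinv σ.A₃ * σ.C₃ + pinv (σ.A₄ * σ.A₃) * σ.C₄ * σ.B₃
        + pinv (σ.A₄ * σ.A₃) * σ.A₄ * projR σ.A₃ * σ.C₃
        + projL σ.A₃ * P.toRows₂ + Q.toCols₂ * σ.B₄ * σ.B₃
        + projL (σ.A₄ * σ.A₃) * T₆ * σ.B₃) ↔
      σ.A₃₃ * P + Q * σ.B₃₃ = σ.E₁ - σ.A₁₁ * W₃ * σ.A₄₄ - σ.B₄₄ * T₆ * σ.B₃ := by
  have hP : σ.A₃₃ * P = σ.A₂ * σ.A₁ * P.toRows₁ - projL σ.A₃ * P.toRows₂ := by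
    conv_lhs => rw [← Matrix.fromRows_toRows P]
    rw [A₃₃, Matrix.fromCols_mul_fromRows, Matrix.neg_mul, sub_eq_add_neg]
  have hQ : Q * σ.B₃₃ = Q.toCols₁ * projR σ.B₂ - Q.toCols₂ * σ.B₄ * σ.B₃ := by
    conv_lhs => rw [← Matrix.fromCols_toCols Q]
    rw [B₃₃, Matrix.fromCols_mul_fromRows, Matrix.mul_neg, sub_eq_add_neg, Matrix.mul_assoc]
  rw [hP, hQ, E₁, B₄₄, Matrix.neg_mul, Matrix.neg_mul, ← sub_eq_zero,
    ← sub_eq_zero (a := σ.A₂ * σ.A₁ * P.toRows₁ - projL σ.A₃ * P.toRows₂ + _)]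
  constructor <;> intro h <;> rw [← h] <;> abel

/-- The left side is the obstruction to solving the gluing equation for the block unknowns once `W₃`
and `T₆` are fixed; distributing the two projectors yields the two-term equation. -/
theorem middle_residual_eq_zero_iff (W₃ : HMat n₂ q₂) (T₆ : HMat n₃ q₄) :
    projR σ.A₃₃ * (σ.E₁ - σ.A₁₁ * W₃ * σ.A₄₄ - σ.B₄₄ * T₆ * σ.B₃) * projL σ.B₃₃ = 0 ↔
      σ.A * W₃ * σ.B + σ.C * T₆ * σ.D = σ.E := by
  rw [eq_comm (b := σ.E), ← sub_eq_zero (a := σ.E), A, B, C, D, E]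
  simp only [Matrix.mul_sub, Matrix.sub_mul, Matrix.mul_add, Matrix.add_mul, Matrix.mul_assoc, sub_sub]

theorem projectorConditions_of_consistent (h : σ.Consistent) : σ.ProjectorConditions := by
  obtain ⟨X₁, X₂, X₃, X₄, X₅, h₁, h₂, h₃, h₄⟩ := h
  have c₁ := two_step_necessary (A₁₁ := σ.A₁₁) (B₁₁ := σ.B₁₁) (C₁₁ := σ.C₁₁) rfl rfl rfl ⟨h₁, h₂⟩
  have c₂ := two_step_necessary (A₁₁ := σ.A₂₂) (B₁₁ := σ.B₂₂) (C₁₁ := σ.C₂₂) rfl rfl rfl ⟨h₃, h₄⟩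
  refine ⟨c₁, c₂, ?_⟩
  obtain ⟨W₁, W₂, W₃, W₄, W₅, W₆, V₁, U₁, hV₁, hU₁, -, -, hX₃⟩ :=
    (two_step_eq_iff rfl rfl rfl c₁.1 c₁.2.1 c₁.2.2 _ _ _).1 ⟨h₁, h₂⟩
  obtain ⟨T₁, T₂, T₃, T₄, T₅, T₆, V₂, U₂, hV₂, hU₂, hX₃', -, -⟩ :=
    (two_step_eq_iff rfl rfl rfl c₂.1 c₂.2.1 c₂.2.2 _ _ _).1 ⟨h₃, h₄⟩
  rw [chain_last_eq rfl c₁.2.1 W₄ W₅ hV₁] at hX₃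
  rw [chain_first_eq c₂.1 T₁ T₄ T₆ hU₂] at hX₃'
  have hm := (σ.middle_eq_iff W₃ T₆ (Matrix.fromRows W₄ T₁) (Matrix.fromCols W₅ T₄)).1
    (hX₃.symm.trans hX₃')
  exact two_term_necessary ((σ.middle_residual_eq_zero_iff W₃ T₆).1
    (projR_mul_mul_projL_of_add hm))

theorem solX₃'_eq_solX₃'' (h : σ.ProjectorConditions)
    (p : ChainParams n₁ n₂ n₃ n₄ n₅ q₁ q₂ q₃ q₄ q₅) :
    σ.solX₃' p = σ.solX₃'' p := by
  obtain ⟨-, -, h₁, h₂, h₃, h₄⟩ := h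
  have hE := (two_term_eq_iff h₁ h₂ h₃ h₄ (σ.W₃ p) (σ.T₆ p)).2
    ⟨p.Z₁, p.Z₂, p.Z₃, p.Z₄, p.Z₅, rfl, rfl⟩
  exact (σ.middle_eq_iff (σ.W₃ p) (σ.T₆ p) (σ.colW₄T₁ p) (σ.rowW₅T₄ p)).2
    ((mul_add_mul_eq_iff ((σ.middle_residual_eq_zero_iff _ _).2 hE) _ _).2
      ⟨p.Z₆, p.Z₇, p.Z₈, rfl, rfl⟩)

theorem solX₃_eq_solX₃'' (h : σ.ProjectorConditions)
    (p : ChainParams n₁ n₂ n₃ n₄ n₅ q₁ q₂ q₃ q₄ q₅) :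
    σ.solX₃ p = σ.solX₃'' p :=
  chain_first_eq h.2.1.1 (σ.T₁ p) (σ.T₄ p) (σ.T₆ p) (V := σ.V₂ p) (U := σ.U₂ p) rfl

/-- The general solution of the system. -/
theorem isSolution_iff (h : σ.ProjectorConditions) (X₁ : HMat n₁ q₁) (X₂ : HMat n₂ q₂)
    (X₃ : HMat n₃ q₃) (X₄ : HMat n₄ q₄) (X₅ : HMat n₅ q₅) :
    σ.IsSolution X₁ X₂ X₃ X₄ X₅ ↔
      ∃ p : ChainParams n₁ n₂ n₃ n₄ n₅ q₁ q₂ q₃ q₄ q₅,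
        X₁ = σ.solX₁ p ∧ X₂ = σ.solX₂ p ∧ X₃ = σ.solX₃ p ∧ X₄ = σ.solX₄ p ∧ X₅ = σ.solX₅ p := by
  have c := h
  obtain ⟨c₁, c₂, k₁, k₂, k₃, k₄⟩ := c
  constructor
  · rintro ⟨h₁, h₂, h₃, h₄⟩
    obtain ⟨W₁, W₂, W₃, W₄, W₅, W₆, V₁, U₁, hV₁, hU₁, hX₁, hX₂, hX₃⟩ :=
      (two_step_eq_iff rfl rfl rfl c₁.1 c₁.2.1 c₁.2.2 _ _ _).1 ⟨h₁, h₂⟩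
    obtain ⟨T₁, T₂, T₃, T₄, T₅, T₆, V₂, U₂, hV₂, hU₂, hX₃', hX₄, hX₅⟩ :=
      (two_step_eq_iff rfl rfl rfl c₂.1 c₂.2.1 c₂.2.2 _ _ _).1 ⟨h₃, h₄⟩
    have e₃ := hX₃
    have e₃' := hX₃'
    rw [chain_last_eq rfl c₁.2.1 W₄ W₅ hV₁] at e₃
    rw [chain_first_eq c₂.1 T₁ T₄ T₆ hU₂] at e₃'
    have hm := (σ.middle_eq_iff W₃ T₆ (Matrix.fromRows W₄ T₁) (Matrix.fromCols W₅ T₄)).1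
      (e₃.symm.trans e₃')
    have hz := projR_mul_mul_projL_of_add hm
    obtain ⟨Z₁, Z₂, Z₃, Z₄, Z₅, hW₃, hT₆⟩ := (two_term_eq_iff k₁ k₂ k₃ k₄ W₃ T₆).1
      ((σ.middle_residual_eq_zero_iff W₃ T₆).1 hz)
    obtain ⟨Z₆, Z₇, Z₈, hP, hQ⟩ := (mul_add_mul_eq_iff hz _ _).1 hm
    -- Only these parameters are free. The remaining ones (`W₃`, `T₆`, the blocks `W₄`, `T₁`, `T₄`)
    -- were constrained by gluing and are now recovered from `p`.
    let p : ChainParams n₁ n₂ n₃ n₄ n₅ q₁ q₂ q₃ q₄ q₅ :=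
      ⟨W₁, W₂, W₆, T₂, T₃, T₅, Z₁, Z₂, Z₃, Z₄, Z₅, Z₆, Z₇, Z₈⟩
    have gW₃ : W₃ = σ.W₃ p := hW₃
    have gT₆ : T₆ = σ.T₆ p := hT₆
    have gP : Matrix.fromRows W₄ T₁ = σ.colW₄T₁ p := by rw [hP, gW₃, gT₆]; rfl
    have gQ : Matrix.fromCols W₅ T₄ = σ.rowW₅T₄ p := by rw [hQ, gW₃, gT₆]; rfl
    have gW₄ : W₄ = σ.W₄ p := congrArg Matrix.toRows₁ gP
    have gT₁ : T₁ = σ.T₁ p := congrArg Matrix.toRows₂ gP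
    have gT₄ : T₄ = σ.T₄ p := congrArg Matrix.toCols₂ gQ
    have gV₁ : V₁ = σ.V₁ p := by rw [hV₁, gW₃]; rfl
    have gV₂ : V₂ = σ.V₂ p := hV₂
    have gU₁ : U₁ = σ.U₁ p := by rw [hU₁, gV₁, gW₄]; rfl
    have gU₂ : U₂ = σ.U₂ p := by rw [hU₂, gV₂, gT₄, gT₆]; rfl
    refine ⟨p, ?_, ?_, ?_, ?_, ?_⟩
    · rw [hX₁, gU₁]; rfl
    · rw [hX₂, gU₁, gV₁]; rfl
    · rw [hX₃', gU₂, gT₁]; rfl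
    · rw [hX₄, gU₂, gV₂]; rfl
    · rw [hX₅, gV₂, gT₄]; rfl
  · rintro ⟨p, rfl, rfl, rfl, rfl, rfl⟩
    have s₁ := (two_step_eq_iff rfl rfl rfl c₁.1 c₁.2.1 c₁.2.2 (σ.solX₁ p) (σ.solX₂ p)
      (σ.solX₃ p)).2 ⟨p.W₁, p.W₂, σ.W₃ p, σ.W₄ p, σ.W₅ p, p.W₆, σ.V₁ p, σ.U₁ p, rfl, rfl, rfl, rfl,
        by
          -- `solX₃` is written with the parameters of the second half, so the first half is reached
          -- through the other two expressions.
          rw [σ.solX₃_eq_solX₃'' h, ← σ.solX₃'_eq_solX₃'' h]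
          exact (chain_last_eq rfl c₁.2.1 (σ.W₄ p) (σ.W₅ p) rfl).symm⟩
    have s₂ := (two_step_eq_iff rfl rfl rfl c₂.1 c₂.2.1 c₂.2.2 (σ.solX₃ p) (σ.solX₄ p)
      (σ.solX₅ p)).2 ⟨σ.T₁ p, p.T₂, p.T₃, σ.T₄ p, p.T₅, σ.T₆ p, σ.V₂ p, σ.U₂ p, rfl, rfl, rfl, rfl,
        rfl⟩
    exact ⟨s₁.1, s₁.2, s₂.1, s₂.2⟩

theorem consistent_of_projectorConditions (h : σ.ProjectorConditions) : σ.Consistent :=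
  ⟨_, _, _, _, _, (σ.isSolution_iff h _ _ _ _ _).2
    -- Any choice of parameters gives a solution; zero is the simplest.
    ⟨⟨0, 0, 0, 0, 0, 0, 0, 0, 0, 0, 0, 0, 0, 0⟩, rfl, rfl, rfl, rfl, rfl⟩⟩

end ChainSystem

theorem theorem6p1 {n₁ n₂ n₃ n₄ n₅ q₁ q₂ q₃ q₄ q₅ : ℕ}
    (σ : ChainSystem n₁ n₂ n₃ n₄ n₅ q₁ q₂ q₃ q₄ q₅) :
    List.TFAE [σ.Consistent, σ.RankConditions, σ.ProjectorConditions] ∧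
    (σ.Consistent →
      (∀ (X₁ : HMat n₁ q₁) (X₂ : HMat n₂ q₂) (X₃ : HMat n₃ q₃) (X₄ : HMat n₄ q₄)
        (X₅ : HMat n₅ q₅),
        σ.IsSolution X₁ X₂ X₃ X₄ X₅ ↔
          ∃ p : ChainParams n₁ n₂ n₃ n₄ n₅ q₁ q₂ q₃ q₄ q₅,
            X₁ = σ.solX₁ p ∧ X₂ = σ.solX₂ p ∧ X₃ = σ.solX₃ p ∧ X₄ = σ.solX₄ p ∧
              X₅ = σ.solX₅ p) ∧
      (∀ p : ChainParams n₁ n₂ n₃ n₄ n₅ q₁ q₂ q₃ q₄ q₅,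
        σ.solX₃ p = σ.solX₃' p ∧ σ.solX₃ p = σ.solX₃'' p)) := by
  refine ⟨?_, fun hc => ?_⟩
  · tfae_have 1 → 2 := σ.rankConditions_of_consistent
    tfae_have 2 → 1 := σ.consistent_of_rankConditions
    tfae_have 1 → 3 := σ.projectorConditions_of_consistent
    tfae_have 3 → 1 := σ.consistent_of_projectorConditions
    tfae_finish
  · have h := σ.projectorConditions_of_consistent hc
    refine ⟨σ.isSolution_iff h, fun p => ⟨?_, σ.solX₃_eq_solX₃'' h p⟩⟩
    rw [σ.solX₃_eq_solX₃'' h, σ.solX₃'_eq_solX₃'' h]
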